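/- Let $(G,\Pi)$ be a connected Poisson-Lie group of dimension $n$: $G$ is a connected (finite-dimensional, real, smooth) Lie group with Lie algebra $\mathfrak g=T_eG$, and $\Pi$ is a smooth Poisson 2-vector on $G$ with $\Pi(gh)=(L_g)_*\Pi(h)+(R_h)_*\Pi(g)$ for all $g,h\in G$. Let $H\in C^\infty(G)$, and let $X_H^\Pi=\Pi^\sharp(\mathrm dH)$ be its Hamiltonian vector field, where $\langle\Pi^\sharp(\alpha),\beta\rangle=\Pi(\alpha,\beta)$. Let $\delta=\mathrm d_e\Pi:\mathfrak g\to\wedge^2\mathfrak g$ be the differential of $\Pi$ at the identity (where $\Pi$ vanishes), let $[\alpha,\beta]_{\mathfrak g^*}(\xi)=\delta(\xi)(\alpha,\beta)$ be the induced Lie bracket on $\mathfrak g^*$, and let $\mathcal M_{\mathfrak g^*}\in\mathfrak g^{**}=\mathfrak g$ be its modular character, $\mathcal M_{\mathfrak g^*}(\alpha)=\operatorname{Tr}([\alpha,\cdot\,]_{\mathfrak g^*})$, with associated left- and right-invariant vector fields $\mathcal M^l_{\mathfrak g^*}$ and $\mathcal M^r_{\mathfrak g^*}$. Let $f_0(g)=\det(\mathrm{Ad}^n_g)$,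 where $\mathrm{Ad}^n$ is the adjoint action of $G$ on $\wedge^n\mathfrak g$ (since $G$ is connected, $f_0>0$). Then $X_H^\Pi$ preserves a volume form on $G$ (that is, $\mathcal L_{X_H^\Pi}\Phi=0$ for some smooth nowhere vanishing $n$-form $\Phi$ on $G$) if and only if there exists $\sigma\in C^\infty(G)$ such that $$X_H^\Pi\bigl(\sigma-\log\sqrt{f_0}\bigr)+\tfrac12\bigl(\mathcal M^l_{\mathfrak g^*}(H)+\mathcal M^r_{\mathfrak g^*}(H)\bigr)=0\quad\text{on } G.$$ Moreover, for every such $\sigma$ and every $0\neq\nu\in\wedge^n\mathfrak g^*$, with $\nu^l$ the left-invariant $n$-form on $G$ whose value at $e$ is $\nu$, the form $e^\sigma\nu^l$ is a volume form preserved by $X_H^\Pi$. -/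

import Mathlib

set_option maxSynthPendingDepth 3

open scoped Manifold ContDiff

noncomputable section

namespace PoissonLie

/-! ## Bivectors on a finite-dimensional vector space -/

section LinearAlgebra

variable {V : Type*} [AddCommGroup V] [Module ℝ V] [TopologicalSpace V]
  [IsTopologicalAddGroup V] [ContinuousSMul ℝ V]
variable {W : Type*} [AddCommGroup W] [Module ℝ W] [TopologicalSpace W]
  [IsTopologicalAddGroup W] [ContinuousSMul ℝ W]

/-- Contravariant 2-tensors on `V`, as bilinear forms on the dual space. A bivector, that is, an
element of `⋀² V`, is a skew-symmetric such form. -/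
abbrev Tensor2 (V : Type*) [AddCommGroup V] [Module ℝ V] [TopologicalSpace V]
    [IsTopologicalAddGroup V] [ContinuousSMul ℝ V] : Type _ :=
  (V →L[ℝ] ℝ) →L[ℝ] (V →L[ℝ] ℝ) →L[ℝ] ℝ

/-- The push-forward of a contravariant 2-tensor along a linear map. -/
def pushforward (L : V →L[ℝ] W) (P : Tensor2 V) : Tensor2 W :=
  (ContinuousLinearMap.precomp ℝ (ContinuousLinearMap.precomp ℝ L)).comp
    (P.comp (ContinuousLinearMap.precomp ℝ L))

theorem pushforward_apply (L : V →L[ℝ] W) (P : Tensor2 V) (α β : W →L[ℝ] ℝ) :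
    pushforward L P α β = P (α.comp L) (β.comp L) := rfl

/-- The vector of a finite-dimensional space that corresponds to an element of the bidual. -/
def ofBidual [T2Space V] [FiniteDimensional ℝ V] (φ : (V →L[ℝ] ℝ) →ₗ[ℝ] ℝ) : V :=
  (Module.evalEquiv ℝ V).symm (φ ∘ₗ
    (LinearMap.toContinuousLinearMap : (V →ₗ[ℝ] ℝ) ≃ₗ[ℝ] (V →L[ℝ] ℝ)).toLinearMap)

theorem apply_ofBidual [T2Space V] [FiniteDimensional ℝ V] (φ : (V →L[ℝ] ℝ) →ₗ[ℝ] ℝ)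
    (β : V →L[ℝ] ℝ) : β (ofBidual φ) = φ β := by
  have h := Module.apply_evalEquiv_symm_apply ℝ V (β : V →ₗ[ℝ] ℝ) (φ ∘ₗ
    (LinearMap.toContinuousLinearMap : (V →ₗ[ℝ] ℝ) ≃ₗ[ℝ] (V →L[ℝ] ℝ)).toLinearMap)
  exact h

end LinearAlgebra

/-! ## Tensor fields, Poisson structures and volume forms on a manifold -/

section Manifold

variable {E : Type*} [NormedAddCommGroup E] [NormedSpace ℝ E]
  {K : Type*} [TopologicalSpace K] (I : ModelWithCorners ℝ E K)
  {M : Type*} [TopologicalSpace M] [ChartedSpace K M] [IsManifold I ∞ M]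

instance (x : M) : T2Space (TangentSpace I x) := inferInstanceAs (T2Space E)

instance [FiniteDimensional ℝ E] (x : M) : FiniteDimensional ℝ (TangentSpace I x) :=
  inferInstanceAs (FiniteDimensional ℝ E)

/-- Smooth real functions. -/
def IsSmoothFun (F : M → ℝ) : Prop := ContMDiff I 𝓘(ℝ, ℝ) ∞ F

/-- Smooth vector fields. -/
def IsSmoothField (X : ∀ x : M, TangentSpace I x) : Prop :=
  ContMDiff I I.tangent ∞ (fun x => (⟨x, X x⟩ : TangentBundle I M))

/-- Smooth 1-forms: those that give smooth functions on smooth vector fields. -/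
def IsSmoothOneForm (α : ∀ x : M, TangentSpace I x →L[ℝ] ℝ) : Prop :=
  ∀ X : ∀ x : M, TangentSpace I x, IsSmoothField I X → IsSmoothFun I (fun x => α x (X x))

/-- The differential `dF (x)` of a real function. -/
def differential (F : M → ℝ) (x : M) : TangentSpace I x →L[ℝ] ℝ := mfderiv I 𝓘(ℝ, ℝ) F x

/-- The function `X(F)`, for a vector field `X` and a real function `F`. -/
def derivAlong (X : ∀ x : M, TangentSpace I x) (F : M → ℝ) (x : M) : ℝ :=
  differential I F x (X x)

/-- The bracket `{F, H} = P(dF, dH)`. -/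
def poissonBracket (P : ∀ x : M, Tensor2 (TangentSpace I x)) (F H : M → ℝ) (x : M) : ℝ :=
  P x (differential I F x) (differential I H x)

/-- Poisson structures: smooth 2-vectors whose bracket of functions satisfies the Jacobi
identity. -/
structure IsPoisson (P : ∀ x : M, Tensor2 (TangentSpace I x)) : Prop where
  skew : ∀ (x : M) (α β : TangentSpace I x →L[ℝ] ℝ), P x α β = -P x β α
  smooth : ∀ α β : ∀ x : M, TangentSpace I x →L[ℝ] ℝ,
    IsSmoothOneForm I α → IsSmoothOneForm I β → IsSmoothFun I (fun x => P x (α x) (β x))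
  jacobi : ∀ F₁ F₂ F₃ : M → ℝ, IsSmoothFun I F₁ → IsSmoothFun I F₂ → IsSmoothFun I F₃ →
    ∀ x : M, poissonBracket I P F₁ (poissonBracket I P F₂ F₃) x
      + poissonBracket I P F₂ (poissonBracket I P F₃ F₁) x
      + poissonBracket I P F₃ (poissonBracket I P F₁ F₂) x = 0

/-- The morphism `P^♯ : T*M → TM`, with `⟨P^♯ α, β⟩ = P(α, β)`. -/
def sharp [FiniteDimensional ℝ E] (P : ∀ x : M, Tensor2 (TangentSpace I x)) (x : M)
    (α : TangentSpace I x →L[ℝ] ℝ) : TangentSpace I x :=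
  ofBidual (P x α).toLinearMap

/-- The Hamiltonian vector field `X_H = P^♯ (dH)`. -/
def hamiltonianField [FiniteDimensional ℝ E] (P : ∀ x : M, Tensor2 (TangentSpace I x))
    (H : M → ℝ) (x : M) : TangentSpace I x :=
  sharp I P x (differential I H x)

/-- Volume forms: smooth differential forms of top degree that vanish nowhere. Smoothness is
tested on smooth vector fields. -/
structure IsVolumeForm
    (Φ : ∀ x : M, TangentSpace I x [⋀^Fin (Module.finrank ℝ E)]→ₗ[ℝ] ℝ) : Prop where
  smooth : ∀ Y : Fin (Module.finrank ℝ E) → ∀ x : M, TangentSpace I x,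
    (∀ i, IsSmoothField I (Y i)) → IsSmoothFun I (fun x => Φ x (fun i => Y i x))
  ne_zero : ∀ x : M, Φ x ≠ 0

/-- The Lie derivative of a form of degree `n`, evaluated on vector fields:
`(L_X Φ)(Y₁, …, Yₙ) = X(Φ(Y₁, …, Yₙ)) - ∑ᵢ Φ(Y₁, …, [X, Yᵢ], …, Yₙ)`. -/
def lieDerivative {n : ℕ} (X : ∀ x : M, TangentSpace I x)
    (Φ : ∀ x : M, TangentSpace I x [⋀^Fin n]→ₗ[ℝ] ℝ)
    (Y : Fin n → ∀ x : M, TangentSpace I x) (x : M) : ℝ :=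
  derivAlong I X (fun y => Φ y (fun i => Y i y)) x
    - ∑ i, Φ x (Function.update (fun j => Y j x) i (VectorField.mlieBracket I X (Y i) x))

/-- The vector field `X` preserves the form `Φ`: `L_X Φ = 0`. -/
def Preserves {n : ℕ} (X : ∀ x : M, TangentSpace I x)
    (Φ : ∀ x : M, TangentSpace I x [⋀^Fin n]→ₗ[ℝ] ℝ) : Prop :=
  ∀ Y : Fin n → ∀ x : M, TangentSpace I x, (∀ i, IsSmoothField I (Y i)) →
    ∀ x : M, lieDerivative I X Φ Y x = 0

end Manifold

/-! ## Lie groups -/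

section Group

variable {E : Type*} [NormedAddCommGroup E] [NormedSpace ℝ E]
  {K : Type*} [TopologicalSpace K] (I : ModelWithCorners ℝ E K)
  {G : Type*} [TopologicalSpace G] [ChartedSpace K G] [Group G] [LieGroup I ∞ G]

/-- Poisson-Lie structures: multiplicative Poisson structures,
`P(gh) = (L_g)_* (P(h)) + (R_h)_* (P(g))`. -/
structure IsPoissonLie (P : ∀ g : G, Tensor2 (TangentSpace I g)) : Prop extends
    IsPoisson I P where
  mult : ∀ g h : G, P (g * h) =
    pushforward (mfderiv I I (fun x : G => g * x) h) (P h)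
      + pushforward (mfderiv I I (fun x : G => x * h) g) (P g)

/-- The left-invariant vector field `ξ^l`. -/
def leftField (ξ : GroupLieAlgebra I G) (g : G) : TangentSpace I g :=
  mulInvariantVectorField ξ g

/-- The right-invariant vector field `ξ^r`. -/
def rightField (ξ : GroupLieAlgebra I G) (g : G) : TangentSpace I g :=
  (mfderiv I I (fun x : G => x * g) (1 : G) : GroupLieAlgebra I G →L[ℝ] E) ξ

/-- The differential at `g` of the translation `x ↦ g⁻¹ x`, from `T_g G` to the Lie algebra. -/
def leftTranslate (g : G) : TangentSpace I g →L[ℝ] GroupLieAlgebra I G :=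
  (mfderiv I I (fun x : G => g⁻¹ * x) g : TangentSpace I g →L[ℝ] E)

/-- The left-invariant form `ν^l`. -/
def leftForm {n : ℕ} (ν : GroupLieAlgebra I G [⋀^Fin n]→ₗ[ℝ] ℝ) (g : G) :
    TangentSpace I g [⋀^Fin n]→ₗ[ℝ] ℝ :=
  ν.compLinearMap (leftTranslate I g).toLinearMap

/-- The adjoint action `Ad_g`, the differential at the identity of `x ↦ g x g⁻¹`. -/
def Ad (g : G) : GroupLieAlgebra I G →L[ℝ] GroupLieAlgebra I G :=
  (mfderiv I I (fun x : G => g * x * g⁻¹) (1 : G) : GroupLieAlgebra I G →L[ℝ] E)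

/-- `f₀(g) = det (Ad^n_g)`, with `Ad^n` the adjoint action on `⋀ⁿ 𝔤` and `n = dim G`. -/
def f₀ (g : G) : ℝ :=
  LinearMap.det (exteriorPower.map (Module.finrank ℝ E) (Ad I g).toLinearMap)

/-- The 2-vector field `P`, trivialized by left translations. The Lie algebra is written as `E`
(which it is by definition), because `E` carries a norm. -/
def leftTrivialization (P : ∀ g : G, Tensor2 (TangentSpace I g)) (g : G) : Tensor2 E :=
  pushforward (W := E) (leftTranslate I g) (P g)

/-- The differential `δ = d_e P : 𝔤 → ⋀² 𝔤` of `P` at the identity. Since `P` vanishes there, it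
does not depend on the trivialization. -/
def cocycle (P : ∀ g : G, Tensor2 (TangentSpace I g)) : E →L[ℝ] Tensor2 E :=
  mfderiv I 𝓘(ℝ, Tensor2 E) (leftTrivialization I P) (1 : G)

/-- The bracket of the dual Lie algebra `𝔤*`, the transpose of `δ`:
`[α, β] (ξ) = δ(ξ)(α, β)`. -/
def dualBracket (P : ∀ g : G, Tensor2 (TangentSpace I g)) :
    (E →L[ℝ] ℝ) →ₗ[ℝ] (E →L[ℝ] ℝ) →ₗ[ℝ] (E →L[ℝ] ℝ) :=
  LinearMap.mk₂ ℝ (fun α β => ((cocycle I P).flip α).flip β)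
    (by intros; ext; simp) (by intros; ext; simp) (by intros; ext; simp) (by intros; ext; simp)

/-- The modular character `α ↦ Tr (ad_α)` of the dual Lie algebra `𝔤*`, an element of
`𝔤** = 𝔤`. -/
def dualModularCharacter [FiniteDimensional ℝ E] (P : ∀ g : G, Tensor2 (TangentSpace I g)) :
    GroupLieAlgebra I G :=
  ofBidual (V := E) (LinearMap.trace ℝ (E →L[ℝ] ℝ) ∘ₗ dualBracket I P)

end Group

end PoissonLie

end

open PoissonLie

/-! Left translations trivialize `TG`, so that everything becomes calculus of functions on `G` with
values in `E` and its tensors. If `X` has trivialization `x`, the trivialized bracket is `D_x y -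
D_y x + [x, y]`. Hence `L_X (φ ν^l) = (X φ + φ div x) ν^l` with `div x = tr (D x) - tr (ad_x)`
(`leftDInv_mlieBracket`, `lieDerivative_smul_leftForm`). Every volume form is a nowhere vanishing
multiple `φ` of a left-invariant one. With `σ = log |φ|`, an invariant volume form therefore exists
exactly when `X σ + div x = 0` has a smooth solution.

For a Hamiltonian field, `x = Q(h, ·)`, where `Q` is the trivialized bivector and `h` the
trivialized `dH`. The trace of `D x` has two parts. In the part that differentiates `h`, the skew
tensor `Q` sees only the antisymmetric part of the second derivative of `H`, which is `h([·, ·])`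
(`sum_contraction`). The part that differentiates `Q` is computed twice from multiplicativity.
Varying the left factor of a product gives the right-invariant modular term
(`leftDeriv_leftTrivialization`). Varying the right factor gives the left-invariant modular term and
corrections in `ad` (`leftDeriv_leftTrivialization_add`). In the average of the two, the correction
that still contains `Q` cancels the first part.

What remains is `div x = ½ (M^l H + M^r H) - ½ tr (ad_x)` (`leftDivergence_leftHamiltonian`). Since
`d log √f₀` is `½ tr ad` in the left trivialization (`modelDeriv_log_sqrt_f₀`), `X σ + div x` is
exactly the left side of the stated equation. -/

noncomputable section

namespace PoissonLie

/-! ### Derivatives of maps between manifolds, with values in the model spaces -/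

section Calculus

open Filter Topology

variable {E : Type*} [NormedAddCommGroup E] [NormedSpace ℝ E]
  {F : Type*} [NormedAddCommGroup F] [NormedSpace ℝ F]
  {F' : Type*} [NormedAddCommGroup F'] [NormedSpace ℝ F']
  {F'' : Type*} [NormedAddCommGroup F''] [NormedSpace ℝ F'']
  {M : Type*} [TopologicalSpace M] [ChartedSpace E M]
  {N : Type*} [TopologicalSpace N] [ChartedSpace F N]
  {N' : Type*} [TopologicalSpace N'] [ChartedSpace F' N']

variable (E F) in
/-- The derivative of a map between manifolds, as a map between the model vector spaces. -/
def modelDeriv (f : M → N) (x : M) : E →L[ℝ] F := mfderiv 𝓘(ℝ, E) 𝓘(ℝ, F) f x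

theorem modelDeriv_comp {g : N → N'} {f : M → N} {x : M}
    (hg : MDifferentiableAt 𝓘(ℝ, F) 𝓘(ℝ, F') g (f x))
    (hf : MDifferentiableAt 𝓘(ℝ, E) 𝓘(ℝ, F) f x) :
    modelDeriv E F' (fun y => g (f y)) x
      = (modelDeriv F F' g (f x)).comp (modelDeriv E F f x) :=
  mfderiv_comp x hg hf

theorem modelDeriv_comp_of_eq {g : N → N'} {f : M → N} {x : M} {y : N}
    (hg : MDifferentiableAt 𝓘(ℝ, F) 𝓘(ℝ, F') g y)
    (hf : MDifferentiableAt 𝓘(ℝ, E) 𝓘(ℝ, F) f x) (hy : f x = y) :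
    modelDeriv E F' (fun y => g (f y)) x
      = (modelDeriv F F' g y).comp (modelDeriv E F f x) := by
  subst hy; exact modelDeriv_comp hg hf

theorem modelDeriv_congr {f g : M → N} {x : M} (h : f =ᶠ[𝓝 x] g) :
    modelDeriv E F f x = modelDeriv E F g x := h.mfderiv_eq

theorem modelDeriv_id (x : M) : modelDeriv E E (fun y : M => y) x = ContinuousLinearMap.id ℝ E :=
  mfderiv_id

theorem modelDeriv_const (c : N) (x : M) : modelDeriv E F (fun _ : M => c) x = 0 :=
  mfderiv_const

theorem modelDeriv_eq_fderiv {f : M → F} {x : M}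
    (hf : MDifferentiableAt 𝓘(ℝ, E) 𝓘(ℝ, F) f x) :
    modelDeriv E F f x = fderiv ℝ (fun u => f ((chartAt E x).symm u)) (chartAt E x x) := by
  have h := hf.mfderiv
  simp only [mfld_simps, fderivWithin_univ] at h
  exact h

theorem modelDeriv_vectorSpace (f : E → F) (x : E) : modelDeriv E F f x = fderiv ℝ f x :=
  mfderiv_eq_fderiv

theorem modelDeriv_fderiv_comp {g : F → F'} {f : M → F} {x : M}
    (hg : DifferentiableAt ℝ g (f x))
    (hf : MDifferentiableAt 𝓘(ℝ, E) 𝓘(ℝ, F) f x) :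
    modelDeriv E F' (fun y => g (f y)) x = (fderiv ℝ g (f x)).comp (modelDeriv E F f x) := by
  rw [modelDeriv_comp hg.mdifferentiableAt hf, modelDeriv_vectorSpace]

theorem modelDeriv_clm_comp (L : F →L[ℝ] F') {f : M → F} {x : M}
    (hf : MDifferentiableAt 𝓘(ℝ, E) 𝓘(ℝ, F) f x) :
    modelDeriv E F' (fun y => L (f y)) x = L.comp (modelDeriv E F f x) := by
  rw [modelDeriv_fderiv_comp L.differentiableAt hf, L.fderiv]

theorem differentiableAt_chart_symm {f : M → F} {x : M}
    (hf : MDifferentiableAt 𝓘(ℝ, E) 𝓘(ℝ, F) f x) :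
    DifferentiableAt ℝ (fun u => f ((chartAt E x).symm u)) (chartAt E x x) := by
  have h := hf.2
  simp only [DifferentiableWithinAtProp, mfld_simps, differentiableWithinAt_univ] at h
  exact h

theorem mdifferentiableAt_clm_apply {A : M → F →L[ℝ] F'} {f : M → F} {x : M}
    (hA : MDifferentiableAt 𝓘(ℝ, E) 𝓘(ℝ, F →L[ℝ] F') A x)
    (hf : MDifferentiableAt 𝓘(ℝ, E) 𝓘(ℝ, F) f x) :
    MDifferentiableAt 𝓘(ℝ, E) 𝓘(ℝ, F') (fun y => A y (f y)) x :=
  hA.clm_apply hf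

theorem modelDeriv_clm_apply {A : M → F →L[ℝ] F'} {f : M → F} {x : M}
    (hA : MDifferentiableAt 𝓘(ℝ, E) 𝓘(ℝ, F →L[ℝ] F') A x)
    (hf : MDifferentiableAt 𝓘(ℝ, E) 𝓘(ℝ, F) f x) (v : E) :
    modelDeriv E F' (fun y => A y (f y)) x v
      = modelDeriv E (F →L[ℝ] F') A x v (f x) + A x (modelDeriv E F f x v) := by
  rw [modelDeriv_eq_fderiv (mdifferentiableAt_clm_apply hA hf), modelDeriv_eq_fderiv hA,
    modelDeriv_eq_fderiv hf,
    fderiv_clm_apply (differentiableAt_chart_symm hA) (differentiableAt_chart_symm hf)]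
  simp [add_comm]

theorem modelDeriv_add {f g : M → F} {x : M}
    (hf : MDifferentiableAt 𝓘(ℝ, E) 𝓘(ℝ, F) f x)
    (hg : MDifferentiableAt 𝓘(ℝ, E) 𝓘(ℝ, F) g x) :
    modelDeriv E F (fun y => f y + g y) x = modelDeriv E F f x + modelDeriv E F g x :=
  mfderiv_add hf hg

theorem contMDiffAt_chartAt (x : M) : ContMDiffAt 𝓘(ℝ, E) 𝓘(ℝ, E) ∞ (chartAt E x) x :=
  contMDiffAt_extChartAt (I := 𝓘(ℝ, E))

/-- The expression of a vector field in the chart at `a`. -/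
def chartField (V : M → E) (a : M) (u : E) : E :=
  (modelDeriv E E (chartAt E a).symm u).inverse (V ((chartAt E a).symm u))

theorem mpullbackWithin_eq_chartField (V : ∀ x : M, TangentSpace 𝓘(ℝ, E) x) (a : M) :
    VectorField.mpullbackWithin 𝓘(ℝ, E) 𝓘(ℝ, E) (extChartAt 𝓘(ℝ, E) a).symm V
      (Set.range 𝓘(ℝ, E)) = chartField (E := E) V a := by
  rw [ModelWithCorners.range_eq_univ, VectorField.mpullbackWithin_univ]
  rfl

section Parameter

variable {P : Type*} [TopologicalSpace P] [ChartedSpace F'' P]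

/-- The base point `a` is fixed and the target is a vector space, so the coordinate changes inside
`inTangentCoordinates` are identities and the derivative itself is smooth in the parameter. -/
theorem contMDiffAt_modelDeriv [IsManifold 𝓘(ℝ, E) ∞ M] [IsManifold 𝓘(ℝ, F'') ∞ P]
    {f : P → M → F} {p : P} {a : M}
    (hf : ContMDiffAt (𝓘(ℝ, F'').prod 𝓘(ℝ, E)) 𝓘(ℝ, F) ∞ (Function.uncurry f) (p, a)) :
    ContMDiffAt 𝓘(ℝ, F'') 𝓘(ℝ, E →L[ℝ] F) ∞ (fun q => modelDeriv E F (f q) a) p := by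
  have h : ContMDiffAt 𝓘(ℝ, F'') 𝓘(ℝ, E →L[ℝ] F) ∞ (inTangentCoordinates 𝓘(ℝ, E) 𝓘(ℝ, F)
      (fun _ => a) (fun q => f q a) (fun q => modelDeriv E F (f q) a) p) p :=
    ContMDiffAt.mfderiv (m := ∞) f (fun _ => a) hf contMDiffAt_const (by simp)
  refine h.congr_of_eventuallyEq (Eventually.of_forall fun q => ?_)
  rw [inTangentCoordinates_eq _ _ _ (mem_chart_source E a) (Set.mem_univ _)]
  ext v
  have h1 := tangentCoordChange_self (I := 𝓘(ℝ, E)) (x := a) (z := a) (v := v)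
    (mem_extChartAt_source a)
  rw [tangentCoordChange_def] at h1
  have h2 : (tangentBundleCore 𝓘(ℝ, F) F).coordChange (achart F (f q a)) (achart F (f p a)) (f q a)
      = ContinuousLinearMap.id ℝ F := tangentBundleCore_coordChange_model_space _ _ _
  rw [h2]
  exact congrArg (modelDeriv E F (f q) a) h1.symm

end Parameter

end Calculus

/-! ### Second derivatives: mixed partials and the Lie bracket as a commutator -/

section SecondDerivative

open Filter Topology

variable {E : Type*} [NormedAddCommGroup E] [NormedSpace ℝ E]
  {F : Type*} [NormedAddCommGroup F] [NormedSpace ℝ F]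
  {F' : Type*} [NormedAddCommGroup F'] [NormedSpace ℝ F']
  {M : Type*} [TopologicalSpace M] [ChartedSpace E M] [IsManifold 𝓘(ℝ, E) ∞ M]
  {N : Type*} [TopologicalSpace N] [ChartedSpace F N] [IsManifold 𝓘(ℝ, F) ∞ N]

theorem contMDiffAt_chartAt_symm {x : M} {u : E} (hu : u ∈ (chartAt E x).target) :
    ContMDiffAt 𝓘(ℝ, E) 𝓘(ℝ, E) ∞ (chartAt E x).symm u :=
  (contMDiffOn_chart_symm u hu).contMDiffAt ((chartAt E x).open_target.mem_nhds hu)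

/-- The tangent space at `x` is identified with `E` through the preferred chart at `x` itself. -/
theorem modelDeriv_chartAt (x : M) :
    modelDeriv E E (chartAt E x) x = ContinuousLinearMap.id ℝ E := by
  ext v
  have h := mfderiv_chartAt_eq_tangentCoordChange (I := 𝓘(ℝ, E)) (mem_chart_source E x)
  have h' := tangentCoordChange_self (I := 𝓘(ℝ, E)) (x := x) (z := x) (v := v)
    (mem_extChartAt_source x)
  exact (congrArg (fun L : E →L[ℝ] E => L v) h).trans h'

theorem two_le_smooth : (2 : WithTop ℕ∞) ≤ ∞ := ENat.LEInfty.out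

theorem eventually_mdifferentiableAt {f : M → F} {x : M}
    (hf : ContMDiffAt 𝓘(ℝ, E) 𝓘(ℝ, F) ∞ f x) :
    ∀ᶠ y in 𝓝 x, MDifferentiableAt 𝓘(ℝ, E) 𝓘(ℝ, F) f y := by
  have h1 : ContMDiffAt 𝓘(ℝ, E) 𝓘(ℝ, F) 1 f x := hf.of_le (by exact_mod_cast le_top)
  filter_upwards [(contMDiffAt_iff_contMDiffAt_nhds (by simp)).1 h1] with y hy
  exact hy.mdifferentiableAt (by simp)

theorem contDiffAt_chart_symm {f : M → F} {x : M}
    (hf : ContMDiffAt 𝓘(ℝ, E) 𝓘(ℝ, F) ∞ f x) :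
    ContDiffAt ℝ ∞ (fun u => f ((chartAt E x).symm u)) (chartAt E x x) := by
  rw [← contMDiffAt_iff_contDiffAt]
  exact ContMDiffAt.comp_of_eq hf (contMDiffAt_chartAt_symm (mem_chart_target E x))
    ((chartAt E x).left_inv (mem_chart_source E x))

theorem eventually_mdifferentiableAt_param {f : M → N → F'} {a : M} {b : N}
    (hf : ContMDiffAt (𝓘(ℝ, E).prod 𝓘(ℝ, F)) 𝓘(ℝ, F') ∞ (Function.uncurry f) (a, b)) :
    ∀ᶠ m in 𝓝 a, MDifferentiableAt 𝓘(ℝ, F) 𝓘(ℝ, F') (f m) b := by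
  have h1 : ContMDiffAt (𝓘(ℝ, E).prod 𝓘(ℝ, F)) 𝓘(ℝ, F') 1 (Function.uncurry f) (a, b) :=
    hf.of_le (by exact_mod_cast le_top)
  have h2 := (contMDiffAt_iff_contMDiffAt_nhds (by simp)).1 h1
  have h3 : Tendsto (fun m : M => (m, b)) (𝓝 a) (𝓝 (a, b)) :=
    (continuous_id.prodMk continuous_const).tendsto a
  filter_upwards [h3.eventually h2] with m hm
  have h4 : ContMDiffAt 𝓘(ℝ, F) 𝓘(ℝ, F') 1 (fun n => Function.uncurry f (m, n)) b :=
    ContMDiffAt.comp b hm (contMDiffAt_const.prodMk contMDiffAt_id)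
  exact h4.mdifferentiableAt (by simp)

/-- Schwarz's theorem: in charts at `a` and `b`, both sides are the second derivative of one
function on `E × F`, evaluated on `(x, 0)` and `(0, y)` in the two orders. -/
theorem modelDeriv_modelDeriv_comm {f : M → N → F'} {a : M} {b : N}
    (hf : ContMDiffAt (𝓘(ℝ, E).prod 𝓘(ℝ, F)) 𝓘(ℝ, F') ∞ (Function.uncurry f) (a, b))
    (x : E) (y : F) :
    modelDeriv E F' (fun m => modelDeriv F F' (f m) b y) a x
      = modelDeriv F F' (fun n => modelDeriv E F' (fun m => f m n) a x) b y := by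
  set φ := chartAt E a
  set ψ := chartAt F b
  set u₀ := φ a
  set v₀ := ψ b
  set f₀ : E × F → F' := fun p => f (φ.symm p.1) (ψ.symm p.2) with hf₀
  have hu₀ : φ.symm u₀ = a := φ.left_inv (mem_chart_source E a)
  have hv₀ : ψ.symm v₀ = b := ψ.left_inv (mem_chart_source F b)
  have hsm : ContDiffAt ℝ ∞ f₀ (u₀, v₀) := by
    rw [← contMDiffAt_iff_contDiffAt]
    have h1 : ContMDiffAt 𝓘(ℝ, E × F) 𝓘(ℝ, E) ∞ (fun p : E × F => φ.symm p.1) (u₀, v₀) :=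
      (contMDiffAt_chartAt_symm (mem_chart_target E a)).comp (u₀, v₀)
        contDiff_fst.contMDiff.contMDiffAt
    have h2 : ContMDiffAt 𝓘(ℝ, E × F) 𝓘(ℝ, F) ∞ (fun p : E × F => ψ.symm p.2) (u₀, v₀) :=
      (contMDiffAt_chartAt_symm (mem_chart_target F b)).comp (u₀, v₀)
        contDiff_snd.contMDiff.contMDiffAt
    exact ContMDiffAt.comp_of_eq (f := fun p : E × F => (φ.symm p.1, ψ.symm p.2)) hf
      (h1.prodMk h2) (by simp only [hu₀, hv₀])
  have hd : ∀ᶠ p in 𝓝 (u₀, v₀), DifferentiableAt ℝ f₀ p := by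
    have h1 : ContDiffAt ℝ 1 f₀ (u₀, v₀) := hsm.of_le (by exact_mod_cast le_top)
    filter_upwards [h1.eventually (by simp)] with p hp
    exact hp.differentiableAt (by simp)
  have hsd : DifferentiableAt ℝ (fderiv ℝ f₀) (u₀, v₀) :=
    (hsm.fderiv_right (m := 1) two_le_smooth).differentiableAt (by simp)
  have hsymm := hsm.isSymmSndFDerivAt (by simpa using two_le_smooth)
  have hsm' : ContMDiffAt (𝓘(ℝ, F).prod 𝓘(ℝ, E)) 𝓘(ℝ, F') ∞
      (Function.uncurry fun n m => f m n) (b, a) :=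
    ContMDiffAt.comp (b, a) (f := fun p : N × M => (p.2, p.1)) hf
      (contMDiffAt_snd.prodMk contMDiffAt_fst)
  have hl : modelDeriv E F' (fun m => modelDeriv F F' (f m) b y) a x
      = fderiv ℝ (fderiv ℝ f₀) (u₀, v₀) (x, 0) (0, y) := by
    rw [modelDeriv_eq_fderiv
      (((contMDiffAt_modelDeriv hf).clm_apply contMDiffAt_const).mdifferentiableAt (by simp))]
    have hc : Tendsto (fun u : E => (u, v₀)) (𝓝 u₀) (𝓝 (u₀, v₀)) :=
      (continuous_id.prodMk continuous_const).tendsto u₀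
    have hs : Tendsto φ.symm (𝓝 u₀) (𝓝 a) := by
      have := φ.continuousAt_symm (mem_chart_target E a)
      rwa [ContinuousAt, hu₀] at this
    have he : (fun u => modelDeriv F F' (f (φ.symm u)) b y)
        =ᶠ[𝓝 u₀] fun u => fderiv ℝ f₀ (u, v₀) (0, y) := by
      filter_upwards [hc.eventually hd, hs.eventually (eventually_mdifferentiableAt_param hf)]
        with u hu hu'
      rw [modelDeriv_eq_fderiv hu']
      have h1 : HasFDerivAt (fun v : F => (u, v)) (ContinuousLinearMap.inr ℝ E F) v₀ :=
        hasFDerivAt_prodMk_right u v₀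
      have h2 := (hu.hasFDerivAt.comp v₀ h1).fderiv
      exact congrArg (fun L : F →L[ℝ] F' => L y) h2
    rw [he.fderiv_eq]
    have h1 : HasFDerivAt (fun u : E => (u, v₀)) (ContinuousLinearMap.inl ℝ E F) u₀ :=
      hasFDerivAt_prodMk_left u₀ v₀
    have h2 := ((hsd.hasFDerivAt.comp u₀ h1).clm_apply (hasFDerivAt_const (0, y) u₀)).fderiv
    refine (congrArg (fun L : E →L[ℝ] F' => L x) h2).trans ?_
    simp
  have hr : modelDeriv F F' (fun n => modelDeriv E F' (fun m => f m n) a x) b y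
      = fderiv ℝ (fderiv ℝ f₀) (u₀, v₀) (0, y) (x, 0) := by
    rw [modelDeriv_eq_fderiv
      (((contMDiffAt_modelDeriv hsm').clm_apply contMDiffAt_const).mdifferentiableAt (by simp))]
    have hc : Tendsto (fun v : F => (u₀, v)) (𝓝 v₀) (𝓝 (u₀, v₀)) :=
      (continuous_const.prodMk continuous_id).tendsto v₀
    have hs : Tendsto ψ.symm (𝓝 v₀) (𝓝 b) := by
      have := ψ.continuousAt_symm (mem_chart_target F b)
      rwa [ContinuousAt, hv₀] at this
    have he : (fun v => modelDeriv E F' (fun m => f m (ψ.symm v)) a x)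
        =ᶠ[𝓝 v₀] fun v => fderiv ℝ f₀ (u₀, v) (x, 0) := by
      filter_upwards [hc.eventually hd, hs.eventually (eventually_mdifferentiableAt_param hsm')]
        with v hv hv'
      rw [modelDeriv_eq_fderiv hv']
      have h1 : HasFDerivAt (fun u : E => (u, v)) (ContinuousLinearMap.inl ℝ E F) u₀ :=
        hasFDerivAt_prodMk_left u₀ v
      have h2 := (hv.hasFDerivAt.comp u₀ h1).fderiv
      exact congrArg (fun L : E →L[ℝ] F' => L x) h2
    rw [he.fderiv_eq]
    have h1 : HasFDerivAt (fun v : F => (u₀, v)) (ContinuousLinearMap.inr ℝ E F) v₀ :=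
      hasFDerivAt_prodMk_right u₀ v₀
    have h2 := ((hsd.hasFDerivAt.comp v₀ h1).clm_apply (hasFDerivAt_const (x, 0) v₀)).fderiv
    refine (congrArg (fun L : F →L[ℝ] F' => L y) h2).trans ?_
    simp
  rw [hl, hr]
  exact hsymm _ _

theorem chartField_self (V : M → E) (a : M) : chartField V a (chartAt E a a) = V a := by
  have h0 : (chartAt E a).symm (chartAt E a a) = a :=
    (chartAt E a).left_inv (mem_chart_source E a)
  have h1 : MDifferentiableAt 𝓘(ℝ, E) 𝓘(ℝ, E) (chartAt E a).symm (chartAt E a a) :=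
    (contMDiffAt_chartAt_symm (mem_chart_target E a)).mdifferentiableAt (by simp)
  have h2 : modelDeriv E E (fun u => chartAt E a ((chartAt E a).symm u)) (chartAt E a a)
      = ContinuousLinearMap.id ℝ E := by
    rw [← modelDeriv_id (chartAt E a a)]
    refine modelDeriv_congr ?_
    filter_upwards [(chartAt E a).open_target.mem_nhds (mem_chart_target E a)] with u hu
    exact (chartAt E a).right_inv hu
  rw [modelDeriv_comp_of_eq ((contMDiffAt_chartAt a).mdifferentiableAt (by simp)) h1 h0,
    modelDeriv_chartAt, ContinuousLinearMap.id_comp] at h2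
  rw [chartField, h2, h0, ContinuousLinearMap.inverse_id, ContinuousLinearMap.id_apply]

theorem modelDeriv_apply_chartField (V : M → E) {f : M → F} {a : M}
    {u : E} (hu : u ∈ (chartAt E a).target)
    (hf : MDifferentiableAt 𝓘(ℝ, E) 𝓘(ℝ, F) f ((chartAt E a).symm u)) :
    modelDeriv E F f ((chartAt E a).symm u) (V ((chartAt E a).symm u))
      = fderiv ℝ (fun w => f ((chartAt E a).symm w)) u (chartField V a u) := by
  have h1 : MDifferentiableAt 𝓘(ℝ, E) 𝓘(ℝ, E) (chartAt E a).symm u :=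
    (contMDiffAt_chartAt_symm hu).mdifferentiableAt (by simp)
  -- `inverse` has the default value `0` on maps that are not invertible, so invertibility on the
  -- chart target must be supplied.
  have hinv : (modelDeriv E E (chartAt E a).symm u).IsInvertible := by
    have := isInvertible_mfderivWithin_extChartAt_symm (I := 𝓘(ℝ, E)) (x := a) (y := u)
      (by simpa using hu)
    rw [ModelWithCorners.range_eq_univ, mfderivWithin_univ] at this
    exact this
  rw [← modelDeriv_vectorSpace, modelDeriv_comp hf h1, ContinuousLinearMap.comp_apply,
    chartField, hinv.self_apply_inverse]

theorem modelDeriv_modelDeriv_apply {V W : M → E} {f : M → F} {a : M}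
    (hW : DifferentiableAt ℝ (chartField W a) (chartAt E a a))
    (hf : ContMDiffAt 𝓘(ℝ, E) 𝓘(ℝ, F) ∞ f a) :
    modelDeriv E F (fun x => modelDeriv E F f x (W x)) a (V a)
      = fderiv ℝ (fderiv ℝ (fun w => f ((chartAt E a).symm w))) (chartAt E a a) (V a) (W a)
        + fderiv ℝ (fun w => f ((chartAt E a).symm w)) (chartAt E a a)
          (fderiv ℝ (chartField W a) (chartAt E a a) (V a)) := by
  set φ := chartAt E a with hφ
  set f₀ : E → F := fun w => f (φ.symm w)
  have hd : DifferentiableAt ℝ (fderiv ℝ f₀) (φ a) :=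
    ((contDiffAt_chart_symm hf).fderiv_right (m := 1) two_le_smooth).differentiableAt (by simp)
  have he : (fun x => modelDeriv E F f x (W x))
      =ᶠ[𝓝 a] fun x => fderiv ℝ f₀ (φ x) (chartField W a (φ x)) := by
    filter_upwards [eventually_mdifferentiableAt hf,
      φ.open_source.mem_nhds (mem_chart_source E a)] with x hx hx'
    have hi : φ.symm (φ x) = x := φ.left_inv hx'
    have h := modelDeriv_apply_chartField W (φ.map_source hx') (f := f) (by rwa [hi])
    rwa [hi] at h
  have hg : DifferentiableAt ℝ (fun u => fderiv ℝ f₀ u (chartField W a u)) (φ a) :=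
    hd.clm_apply hW
  rw [modelDeriv_congr he, modelDeriv_fderiv_comp (g := fun u => fderiv ℝ f₀ u (chartField W a u))
    hg ((contMDiffAt_chartAt a).mdifferentiableAt (by simp)), modelDeriv_chartAt,
    fderiv_clm_apply hd hW, chartField_self]
  simp [add_comm]

/-- In the chart at `a`, the Hessian of `f` is symmetric and drops out of the commutator; the
derivatives of the components of `V` and `W` remain, and they make up the bracket. Vector-valued `f`
are allowed so that a single function can determine a tangent vector. -/
theorem modelDeriv_mlieBracket [CompleteSpace E] {V W : M → E} {f : M → F} {a : M}
    (hV : MDifferentiableAt 𝓘(ℝ, E) 𝓘(ℝ, E).tangent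
      (fun x => (⟨x, V x⟩ : TangentBundle 𝓘(ℝ, E) M)) a)
    (hW : MDifferentiableAt 𝓘(ℝ, E) 𝓘(ℝ, E).tangent
      (fun x => (⟨x, W x⟩ : TangentBundle 𝓘(ℝ, E) M)) a)
    (hf : ContMDiffAt 𝓘(ℝ, E) 𝓘(ℝ, F) ∞ f a) :
    modelDeriv E F f a (VectorField.mlieBracket 𝓘(ℝ, E) V W a)
      = modelDeriv E F (fun x => modelDeriv E F f x (W x)) a (V a)
        - modelDeriv E F (fun x => modelDeriv E F f x (V x)) a (W a) := by
  have key : ∀ {U : M → E}, MDifferentiableAt 𝓘(ℝ, E) 𝓘(ℝ, E).tangent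
      (fun x => (⟨x, U x⟩ : TangentBundle 𝓘(ℝ, E) M)) a →
      DifferentiableAt ℝ (chartField U a) (chartAt E a a) := by
    intro U hU
    have h := MDifferentiableWithinAt.differentiableWithinAt_mpullbackWithin_vectorField
      (I := 𝓘(ℝ, E)) (V := U) (s := Set.univ) (x := a) hU
    rw [mpullbackWithin_eq_chartField U a, ModelWithCorners.range_eq_univ, Set.preimage_univ,
      Set.univ_inter] at h
    exact differentiableWithinAt_univ.1 h
  have hbr : (VectorField.mlieBracket 𝓘(ℝ, E) V W a : E)
      = fderiv ℝ (chartField W a) (chartAt E a a) (V a)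
        - fderiv ℝ (chartField V a) (chartAt E a a) (W a) := by
    have h1 := VectorField.mlieBracketWithin_apply (I := 𝓘(ℝ, E)) (V := V) (W := W)
      (s := Set.univ) (x₀ := a)
    rw [mpullbackWithin_eq_chartField V a, mpullbackWithin_eq_chartField W a,
      ModelWithCorners.range_eq_univ, Set.preimage_univ, Set.univ_inter,
      VectorField.lieBracketWithin_univ] at h1
    have h2 : (mfderiv 𝓘(ℝ, E) 𝓘(ℝ, E) (extChartAt 𝓘(ℝ, E) a) a : E →L[ℝ] E)
        = ContinuousLinearMap.id ℝ E := modelDeriv_chartAt a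
    have h3 : (VectorField.mlieBracket 𝓘(ℝ, E) V W a : E)
        = (ContinuousLinearMap.id ℝ E).inverse
          (VectorField.lieBracket ℝ (chartField V a) (chartField W a) (chartAt E a a)) := by
      rw [← h2]; exact h1
    rw [h3, ContinuousLinearMap.inverse_id, ContinuousLinearMap.id_apply, VectorField.lieBracket,
      chartField_self, chartField_self]
  have hsymm := (contDiffAt_chart_symm hf).isSymmSndFDerivAt (by simpa using two_le_smooth)
  rw [modelDeriv_modelDeriv_apply (key hW) hf, modelDeriv_modelDeriv_apply (key hV) hf,
    modelDeriv_eq_fderiv (hf.mdifferentiableAt (by simp)), hsymm (V a) (W a), hbr, map_sub]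
  abel

end SecondDerivative

/-! ### Left-invariant calculus on a Lie group -/

section LieGroupCalculus

open Filter Topology

variable {E : Type*} [NormedAddCommGroup E] [NormedSpace ℝ E]
  {F : Type*} [NormedAddCommGroup F] [NormedSpace ℝ F]
  {F' : Type*} [NormedAddCommGroup F'] [NormedSpace ℝ F']
  {G : Type*} [TopologicalSpace G] [ChartedSpace E G] [Group G]

variable (E) in
/-- The differential at the identity of the left translation by `g`. -/
def leftD (g : G) : E →L[ℝ] E := modelDeriv E E (fun x : G => g * x) 1

variable (E) in
/-- The differential at `g` of the left translation by `g⁻¹`. -/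
def leftDInv (g : G) : E →L[ℝ] E := modelDeriv E E (fun x : G => g⁻¹ * x) g

variable (E) in
/-- The derivative of a vector-valued function along left-invariant vector fields. -/
def leftDeriv (f : G → F) (g : G) : E →L[ℝ] F := modelDeriv E F (fun k => f (g * k)) 1

variable (E) in
/-- The adjoint action, on the model space. -/
def adjoint (g : G) : E →L[ℝ] E := modelDeriv E E (fun x : G => g * x * g⁻¹) 1

theorem adjoint_one : adjoint E (1 : G) = ContinuousLinearMap.id ℝ E := by
  simp only [adjoint, one_mul, inv_one, mul_one]
  exact modelDeriv_id _

variable [LieGroup 𝓘(ℝ, E) ∞ G]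

theorem mdifferentiableAt_mul_left (g k : G) :
    MDifferentiableAt 𝓘(ℝ, E) 𝓘(ℝ, E) (fun x : G => g * x) k :=
  (contMDiff_mul_left (I := 𝓘(ℝ, E)) (n := ∞)).contMDiffAt.mdifferentiableAt (by simp)

theorem mdifferentiableAt_mul_right (g k : G) :
    MDifferentiableAt 𝓘(ℝ, E) 𝓘(ℝ, E) (fun x : G => x * g) k :=
  (contMDiff_mul_right (I := 𝓘(ℝ, E)) (n := ∞)).contMDiffAt.mdifferentiableAt (by simp)

theorem leftDInv_leftD (g : G) (v : E) : leftDInv E g (leftD E g v) = v := by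
  have h := modelDeriv_comp_of_eq (f := fun x : G => g * x) (g := fun x : G => g⁻¹ * x) (x := 1)
    (mdifferentiableAt_mul_left (E := E) g⁻¹ g) (mdifferentiableAt_mul_left (E := E) g 1)
    (mul_one g)
  simp only [inv_mul_cancel_left, modelDeriv_id] at h
  exact (congrArg (fun L : E →L[ℝ] E => L v) h).symm

theorem leftD_leftDInv (g : G) (v : E) : leftD E g (leftDInv E g v) = v := by
  have h := modelDeriv_comp_of_eq (f := fun x : G => g⁻¹ * x) (g := fun x : G => g * x) (x := g)
    (mdifferentiableAt_mul_left (E := E) g 1) (mdifferentiableAt_mul_left (E := E) g⁻¹ g)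
    (inv_mul_cancel g)
  simp only [mul_inv_cancel_left, modelDeriv_id] at h
  exact (congrArg (fun L : E →L[ℝ] E => L v) h).symm

theorem leftDeriv_eq {f : G → F} {g : G} (hf : MDifferentiableAt 𝓘(ℝ, E) 𝓘(ℝ, F) f g) :
    leftDeriv E f g = (modelDeriv E F f g).comp (leftD E g) :=
  modelDeriv_comp_of_eq hf (mdifferentiableAt_mul_left g 1) (mul_one g)

theorem modelDeriv_eq_leftDeriv {f : G → F} {g : G}
    (hf : MDifferentiableAt 𝓘(ℝ, E) 𝓘(ℝ, F) f g) (v : E) :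
    modelDeriv E F f g v = leftDeriv E f g (leftDInv E g v) := by
  rw [leftDeriv_eq hf, ContinuousLinearMap.comp_apply, leftD_leftDInv]

theorem mdifferentiableAt_comp_mul_left {f : G → F} {g : G}
    (hf : MDifferentiableAt 𝓘(ℝ, E) 𝓘(ℝ, F) f g) :
    MDifferentiableAt 𝓘(ℝ, E) 𝓘(ℝ, F) (fun k => f (g * k)) 1 :=
  MDifferentiableAt.comp_of_eq 1 hf (mdifferentiableAt_mul_left g 1) (mul_one g)

theorem contMDiffAt_leftDeriv {f : G → F} {g : G} (hf : ContMDiffAt 𝓘(ℝ, E) 𝓘(ℝ, F) ∞ f g) :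
    ContMDiffAt 𝓘(ℝ, E) 𝓘(ℝ, E →L[ℝ] F) ∞ (leftDeriv E f) g :=
  contMDiffAt_modelDeriv (f := fun g k => f (g * k)) <|
    ContMDiffAt.comp_of_eq (f := fun p : G × G => p.1 * p.2) hf
      ((contMDiff_mul 𝓘(ℝ, E) ∞).contMDiffAt) (mul_one g)

theorem leftDeriv_clm_apply {A : G → F →L[ℝ] F'} {f : G → F} {g : G}
    (hA : MDifferentiableAt 𝓘(ℝ, E) 𝓘(ℝ, F →L[ℝ] F') A g)
    (hf : MDifferentiableAt 𝓘(ℝ, E) 𝓘(ℝ, F) f g) (v : E) :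
    leftDeriv E (fun y => A y (f y)) g v = leftDeriv E A g v (f g) + A g (leftDeriv E f g v) := by
  have h := modelDeriv_clm_apply (mdifferentiableAt_comp_mul_left hA)
    (mdifferentiableAt_comp_mul_left hf) v
  rw [mul_one] at h
  exact h

/-! ### The adjoint representation -/

theorem mdifferentiableAt_conj (g k : G) :
    MDifferentiableAt 𝓘(ℝ, E) 𝓘(ℝ, E) (fun x : G => g * x * g⁻¹) k :=
  MDifferentiableAt.comp k (mdifferentiableAt_mul_right g⁻¹ (g * k))
    (mdifferentiableAt_mul_left g k)

theorem adjoint_mul (g k : G) : adjoint E (g * k) = (adjoint E g).comp (adjoint E k) := by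
  have h := modelDeriv_comp_of_eq (f := fun x : G => k * x * k⁻¹) (g := fun x : G => g * x * g⁻¹)
    (x := 1) (y := 1)
    (mdifferentiableAt_conj (E := E) g 1) (mdifferentiableAt_conj (E := E) k 1) (by simp)
  rw [adjoint, adjoint, adjoint, ← h]
  congr 1
  ext x
  simp only [mul_inv_rev, mul_assoc]

theorem adjoint_inv_adjoint (g : G) (v : E) : adjoint E g⁻¹ (adjoint E g v) = v := by
  rw [← ContinuousLinearMap.comp_apply, ← adjoint_mul, inv_mul_cancel, adjoint_one,
    ContinuousLinearMap.id_apply]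

theorem adjoint_adjoint_inv (g : G) (v : E) : adjoint E g (adjoint E g⁻¹ v) = v := by
  rw [← ContinuousLinearMap.comp_apply, ← adjoint_mul, mul_inv_cancel, adjoint_one,
    ContinuousLinearMap.id_apply]

theorem contMDiffAt_adjoint (g : G) :
    ContMDiffAt 𝓘(ℝ, E) 𝓘(ℝ, E →L[ℝ] E) ∞ (adjoint E : G → E →L[ℝ] E) g := by
  have h1 : (adjoint E : G → E →L[ℝ] E)
      = fun g => modelDeriv E E (fun x : G => chartAt E (1 : G) (g * x * g⁻¹)) 1 := by
    funext g
    rw [modelDeriv_comp_of_eq (y := 1) ((contMDiffAt_chartAt (1 : G)).mdifferentiableAt (by simp))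
      (mdifferentiableAt_conj (E := E) g 1) (by simp), modelDeriv_chartAt,
      ContinuousLinearMap.id_comp, adjoint]
  rw [h1]
  refine contMDiffAt_modelDeriv (f := fun (g : G) x => chartAt E (1 : G) (g * x * g⁻¹)) ?_
  refine ContMDiffAt.comp_of_eq (f := fun p : G × G => p.1 * p.2 * p.1⁻¹)
    (contMDiffAt_chartAt (1 : G)) ?_ (by simp)
  exact (contMDiffAt_fst.mul contMDiffAt_snd).mul contMDiffAt_fst.inv

variable (E G) in
/-- The bracket of the Lie algebra, as the differential of the adjoint action. -/
def adBracket : E →L[ℝ] E →L[ℝ] E := modelDeriv E (E →L[ℝ] E) (adjoint E : G → E →L[ℝ] E) 1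

theorem leftDeriv_adjoint_apply_one (v w : E) :
    modelDeriv E E (fun g : G => adjoint E g v) 1 w = adBracket E G w v := by
  rw [modelDeriv_clm_apply ((contMDiffAt_adjoint 1).mdifferentiableAt (by simp))
    mdifferentiableAt_const, modelDeriv_const]
  simp [adBracket]

/-- This is the chain rule for `g k = (g k g⁻¹) g`. -/
theorem leftDeriv_eq_rightDeriv {f : G → F} {g : G}
    (hf : MDifferentiableAt 𝓘(ℝ, E) 𝓘(ℝ, F) f g) :
    leftDeriv E f g = (modelDeriv E F (fun k => f (k * g)) 1).comp (adjoint E g) := by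
  have h1 : MDifferentiableAt 𝓘(ℝ, E) 𝓘(ℝ, F) (fun k => f (k * g)) 1 :=
    MDifferentiableAt.comp_of_eq 1 hf (mdifferentiableAt_mul_right g 1) (one_mul g)
  have h2 := modelDeriv_comp_of_eq (f := fun x : G => g * x * g⁻¹) (x := 1) h1
    (mdifferentiableAt_conj (E := E) g 1) (by simp)
  rw [adjoint, ← h2, leftDeriv]
  simp only [inv_mul_cancel_right]

/-- Near the identity the left derivative along `w` is the right-translation derivative `r g`
applied to `Ad_g w`. Differentiating `Ad_g` gives the bracket. Differentiating `r` gives a mixed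
partial of `f (k g)`, which by symmetry is the other iterated derivative. -/
theorem leftDeriv_leftDeriv_sub_one {f : G → F} (hf : ContMDiffAt 𝓘(ℝ, E) 𝓘(ℝ, F) ∞ f 1)
    (v w : E) :
    modelDeriv E F (fun g => leftDeriv E f g w) 1 v
      - modelDeriv E F (fun g => leftDeriv E f g v) 1 w = modelDeriv E F f 1 (adBracket E G v w) := by
  set r : G → E →L[ℝ] F := fun g => modelDeriv E F (fun k => f (k * g)) 1
  have hf' : ContMDiffAt (𝓘(ℝ, E).prod 𝓘(ℝ, E)) 𝓘(ℝ, F) ∞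
      (Function.uncurry fun g k => f (k * g)) ((1 : G), (1 : G)) :=
    ContMDiffAt.comp_of_eq (f := fun p : G × G => p.2 * p.1) hf
      (contMDiffAt_snd.mul contMDiffAt_fst) (by simp)
  have hr : ContMDiffAt 𝓘(ℝ, E) 𝓘(ℝ, E →L[ℝ] F) ∞ r 1 := contMDiffAt_modelDeriv hf'
  have hr' : MDifferentiableAt 𝓘(ℝ, E) 𝓘(ℝ, E →L[ℝ] F) r 1 := hr.mdifferentiableAt (by simp)
  have had : MDifferentiableAt 𝓘(ℝ, E) 𝓘(ℝ, E) (fun g : G => adjoint E g w) 1 :=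
    ((contMDiffAt_adjoint 1).clm_apply contMDiffAt_const).mdifferentiableAt (by simp)
  have he : (fun g => leftDeriv E f g w) =ᶠ[𝓝 1] fun g => r g (adjoint E g w) := by
    filter_upwards [eventually_mdifferentiableAt hf] with g hg
    rw [leftDeriv_eq_rightDeriv hg, ContinuousLinearMap.comp_apply]
  have h1 := modelDeriv_clm_apply hr' (mdifferentiableAt_const (c := w)) v
  rw [modelDeriv_const, zero_apply, map_zero, add_zero] at h1
  have hr1 : r 1 = modelDeriv E F f 1 := by simp only [r, mul_one]
  rw [modelDeriv_congr he, modelDeriv_clm_apply hr' had, leftDeriv_adjoint_apply_one, adjoint_one,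
    ContinuousLinearMap.id_apply, ← h1, modelDeriv_modelDeriv_comm hf', hr1]
  exact add_sub_cancel_left _ _

theorem leftDeriv_leftDeriv_sub {f : G → F} {g : G} (hf : ContMDiffAt 𝓘(ℝ, E) 𝓘(ℝ, F) ∞ f g)
    (v w : E) :
    leftDeriv E (leftDeriv E f) g v w - leftDeriv E (leftDeriv E f) g w v
      = leftDeriv E f g (adBracket E G v w) := by
  have hd : MDifferentiableAt 𝓘(ℝ, E) 𝓘(ℝ, E →L[ℝ] F) (leftDeriv E f) g :=
    (contMDiffAt_leftDeriv hf).mdifferentiableAt (by simp)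
  have h1 : ∀ v w, leftDeriv E (leftDeriv E f) g v w
      = modelDeriv E F (fun k => leftDeriv E (fun l => f (g * l)) k w) 1 v := by
    intro v w
    have h := leftDeriv_clm_apply hd (mdifferentiableAt_const (c := w)) v
    have h0 : leftDeriv E (fun _ : G => w) g v = 0 := by
      rw [leftDeriv, modelDeriv_const, zero_apply]
    rw [h0, map_zero, add_zero] at h
    rw [← h]
    simp only [leftDeriv, mul_assoc]
  have hf' : ContMDiffAt 𝓘(ℝ, E) 𝓘(ℝ, F) ∞ (fun l => f (g * l)) 1 :=
    ContMDiffAt.comp_of_eq hf contMDiff_mul_left.contMDiffAt (mul_one g)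
  rw [h1, h1, leftDeriv_leftDeriv_sub_one hf', leftDeriv]

/-- The chart at the identity, translated to `g`, has the identity as left derivative at `g`. -/
theorem exists_leftDeriv_eq_id (g : G) : ∃ f : G → E, ContMDiffAt 𝓘(ℝ, E) 𝓘(ℝ, E) ∞ f g ∧
    leftDeriv E f g = ContinuousLinearMap.id ℝ E := by
  refine ⟨fun k => chartAt E (1 : G) (g⁻¹ * k), ?_, ?_⟩
  · exact ContMDiffAt.comp_of_eq (contMDiffAt_chartAt (1 : G)) contMDiff_mul_left.contMDiffAt
      (inv_mul_cancel g)
  · simp only [leftDeriv, inv_mul_cancel_left]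
    exact modelDeriv_chartAt (1 : G)

/-- The bracket is a commutator of derivations, tested on a function whose left derivative at the
identity is the identity map. -/
theorem adBracket_skew (v w : E) : adBracket E G v w = -adBracket E G w v := by
  obtain ⟨f, hf, h⟩ := exists_leftDeriv_eq_id (E := E) (1 : G)
  have h1 := leftDeriv_leftDeriv_sub hf v w
  have h2 := leftDeriv_leftDeriv_sub hf w v
  rw [h, ContinuousLinearMap.id_apply] at h1 h2
  rw [← h1, ← h2, neg_sub]

/-- Both sides are compared through a function `f` with left derivative the identity at `g`. In the
commutator of `X` and `Y` on `f`, the second left derivatives of `f` antisymmetrize to `adBracket`,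
and the product rule gives the other two terms. -/
theorem leftDInv_mlieBracket [CompleteSpace E] {X Y : G → E} {g : G}
    (hX : MDifferentiableAt 𝓘(ℝ, E) 𝓘(ℝ, E).tangent
      (fun x => (⟨x, X x⟩ : TangentBundle 𝓘(ℝ, E) G)) g)
    (hY : MDifferentiableAt 𝓘(ℝ, E) 𝓘(ℝ, E).tangent
      (fun x => (⟨x, Y x⟩ : TangentBundle 𝓘(ℝ, E) G)) g)
    (hX' : MDifferentiableAt 𝓘(ℝ, E) 𝓘(ℝ, E) (fun x => leftDInv E x (X x)) g)
    (hY' : MDifferentiableAt 𝓘(ℝ, E) 𝓘(ℝ, E) (fun x => leftDInv E x (Y x)) g) :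
    leftDInv E g (VectorField.mlieBracket 𝓘(ℝ, E) X Y g)
      = leftDeriv E (fun x => leftDInv E x (Y x)) g (leftDInv E g (X g))
        - leftDeriv E (fun x => leftDInv E x (X x)) g (leftDInv E g (Y g))
        + adBracket E G (leftDInv E g (X g)) (leftDInv E g (Y g)) := by
  obtain ⟨f, hf, hid⟩ := exists_leftDeriv_eq_id (E := E) g
  have hd := hf.mdifferentiableAt (by simp)
  have hdd : MDifferentiableAt 𝓘(ℝ, E) 𝓘(ℝ, E →L[ℝ] E) (leftDeriv E f) g :=
    (contMDiffAt_leftDeriv hf).mdifferentiableAt (by simp)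
  have key : ∀ {X Y : G → E},
      MDifferentiableAt 𝓘(ℝ, E) 𝓘(ℝ, E) (fun x => leftDInv E x (Y x)) g →
      modelDeriv E E (fun x => modelDeriv E E f x (Y x)) g (X g)
        = leftDeriv E (leftDeriv E f) g (leftDInv E g (X g)) (leftDInv E g (Y g))
          + leftDeriv E (fun x => leftDInv E x (Y x)) g (leftDInv E g (X g)) := by
    intro X Y hY
    have he : (fun x => modelDeriv E E f x (Y x))
        =ᶠ[𝓝 g] fun x => leftDeriv E f x (leftDInv E x (Y x)) := by
      filter_upwards [eventually_mdifferentiableAt hf] with x hx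
      rw [modelDeriv_eq_leftDeriv hx]
    rw [modelDeriv_congr he, modelDeriv_eq_leftDeriv (mdifferentiableAt_clm_apply hdd hY),
      leftDeriv_clm_apply hdd hY, hid, ContinuousLinearMap.id_apply]
  have h1 := modelDeriv_mlieBracket hX hY hf
  have h2 := leftDeriv_leftDeriv_sub hf (leftDInv E g (X g)) (leftDInv E g (Y g))
  rw [hid, ContinuousLinearMap.id_apply] at h2
  have h3 := modelDeriv_eq_leftDeriv hd (VectorField.mlieBracket 𝓘(ℝ, E) X Y g)
  rw [hid, ContinuousLinearMap.id_apply] at h3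
  rw [← h3, h1, key hY', key hX', ← h2]
  abel

end LieGroupCalculus

/-! ### Smoothness of left trivializations, and multiplicativity of the bivector -/

section Smoothness

open Filter Topology Bundle

variable {E : Type*} [NormedAddCommGroup E] [NormedSpace ℝ E]
  {F : Type*} [NormedAddCommGroup F] [NormedSpace ℝ F]
  {F' : Type*} [NormedAddCommGroup F'] [NormedSpace ℝ F']
  {M : Type*} [TopologicalSpace M] [ChartedSpace E M]

/-- Smoothness of a bivector field is given only on pairs of 1-forms; this upgrades it to smoothness
as an operator-valued map. -/
theorem contMDiff_clm_of_apply [FiniteDimensional ℝ F] {A : M → F →L[ℝ] F'}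
    (h : ∀ v, ContMDiff 𝓘(ℝ, E) 𝓘(ℝ, F') ∞ fun x => A x v) :
    ContMDiff 𝓘(ℝ, E) 𝓘(ℝ, F →L[ℝ] F') ∞ A := by
  let b := Module.finBasis ℝ F
  have hA : A = fun x => ∑ i, ContinuousLinearMap.smulRightL ℝ F F'
      (LinearMap.toContinuousLinearMap (b.coord i)) (A x (b i)) := by
    funext x
    ext v
    conv_lhs => rw [← b.sum_repr v, map_sum]
    simp
  rw [hA]
  exact contMDiff_finsetSum fun i _ => (ContinuousLinearMap.contMDiff _).comp (h _)

theorem contMDiff_of_dual_apply [FiniteDimensional ℝ F] {f : M → F}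
    (h : ∀ β : F →L[ℝ] ℝ, ContMDiff 𝓘(ℝ, E) 𝓘(ℝ, ℝ) ∞ fun x => β (f x)) :
    ContMDiff 𝓘(ℝ, E) 𝓘(ℝ, F) ∞ f := by
  let b := Module.finBasis ℝ F
  have hf : f = fun x => ∑ i, LinearMap.toContinuousLinearMap (b.coord i) (f x) • b i := by
    funext x
    conv_lhs => rw [← b.sum_repr (f x)]
    simp
  rw [hf]
  exact contMDiff_finsetSum fun i _ => (h _).smul contMDiff_const

variable {G : Type*} [TopologicalSpace G] [ChartedSpace E G] [Group G] [LieGroup 𝓘(ℝ, E) ∞ G]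

theorem contMDiff_tangentVector_iff {x : G} {y : G → E} :
    ContMDiff 𝓘(ℝ, E) 𝓘(ℝ, E).tangent ∞ (fun g => (⟨x, y g⟩ : TangentBundle 𝓘(ℝ, E) G))
      ↔ ContMDiff 𝓘(ℝ, E) 𝓘(ℝ, E) ∞ y := by
  have h : ∀ v : E, (trivializationAt E (TangentSpace 𝓘(ℝ, E)) x
      (⟨x, v⟩ : TangentBundle 𝓘(ℝ, E) G)).2 = v := fun v =>
    tangentCoordChange_self (I := 𝓘(ℝ, E)) (x := x) (z := x) (v := v) (mem_extChartAt_source x)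
  refine forall_congr' fun g => ?_
  rw [contMDiffAt_totalSpace]
  simp only [h]
  exact and_iff_right contMDiffAt_const

/-- Translations depend smoothly on the translating element because they are the tangent map of
multiplication with a zero vector in the other slot. This is how `leftD` and `leftDInv` are seen to
preserve smoothness. -/
theorem contMDiff_tangentMap_mul {a b : G → TangentBundle 𝓘(ℝ, E) G}
    (ha : ContMDiff 𝓘(ℝ, E) 𝓘(ℝ, E).tangent ∞ a) (hb : ContMDiff 𝓘(ℝ, E) 𝓘(ℝ, E).tangent ∞ b) :
    ContMDiff 𝓘(ℝ, E) 𝓘(ℝ, E).tangent ∞ fun g =>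
      tangentMap (𝓘(ℝ, E).prod 𝓘(ℝ, E)) 𝓘(ℝ, E) (fun p : G × G => p.1 * p.2)
        ((equivTangentBundleProd 𝓘(ℝ, E) G 𝓘(ℝ, E) G).symm (a g, b g)) :=
  (ContMDiff.contMDiff_tangentMap (contMDiff_mul 𝓘(ℝ, E) ∞) (by simp)).comp
    (contMDiff_equivTangentBundleProd_symm.comp (ha.prodMk hb))

theorem tangentMap_mul_apply (a b : TangentBundle 𝓘(ℝ, E) G) :
    tangentMap (𝓘(ℝ, E).prod 𝓘(ℝ, E)) 𝓘(ℝ, E) (fun p : G × G => p.1 * p.2)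
        ((equivTangentBundleProd 𝓘(ℝ, E) G 𝓘(ℝ, E) G).symm (a, b))
      = ⟨a.1 * b.1, (modelDeriv E E (fun x : G => x * b.1) a.1 a.2
          + modelDeriv E E (fun x : G => a.1 * x) b.1 b.2 : E)⟩ := by
  simp only [tangentMap]
  rw [mfderiv_prod_eq_add_apply
    ((contMDiff_mul 𝓘(ℝ, E) ∞).mdifferentiable (by simp) |>.mdifferentiableAt)]
  rfl

theorem isSmoothField_leftD_apply {y : G → E} (hy : ContMDiff 𝓘(ℝ, E) 𝓘(ℝ, E) ∞ y) :
    IsSmoothField 𝓘(ℝ, E) (M := G) fun g => leftD E g (y g) := by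
  have h0 : ContMDiff 𝓘(ℝ, E) 𝓘(ℝ, E).tangent ∞
      (fun g => (⟨1, y g⟩ : TangentBundle 𝓘(ℝ, E) G)) := contMDiff_tangentVector_iff.2 hy
  have h := contMDiff_tangentMap_mul (contMDiff_zeroSection ℝ (TangentSpace 𝓘(ℝ, E))) h0
  simp only [tangentMap_mul_apply] at h
  refine h.congr fun g => ?_
  have h1 : (modelDeriv E E (fun x : G => x * 1) g 0 + modelDeriv E E (fun x : G => g * x) 1 (y g))
      = leftD E g (y g) := by
    rw [map_zero, zero_add, leftD]
  exact TotalSpace.ext (mul_one g).symm (heq_of_eq h1.symm)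

theorem contMDiff_leftDInv_apply {X : G → E} (hX : IsSmoothField 𝓘(ℝ, E) (M := G) X) :
    ContMDiff 𝓘(ℝ, E) 𝓘(ℝ, E) ∞ fun g => leftDInv E g (X g) := by
  have h0 : ContMDiff 𝓘(ℝ, E) 𝓘(ℝ, E).tangent ∞
      (fun g => (⟨g⁻¹, 0⟩ : TangentBundle 𝓘(ℝ, E) G)) :=
    (contMDiff_zeroSection ℝ (TangentSpace 𝓘(ℝ, E))).comp (contMDiff_inv 𝓘(ℝ, E) ∞)
  have h := contMDiff_tangentMap_mul h0 hX
  simp only [tangentMap_mul_apply] at h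
  rw [← contMDiff_tangentVector_iff (x := (1 : G))]
  refine h.congr fun g => ?_
  have h1 : (modelDeriv E E (fun x : G => x * g) g⁻¹ 0
      + modelDeriv E E (fun x : G => g⁻¹ * x) g (X g)) = leftDInv E g (X g) := by
    rw [map_zero, zero_add, leftDInv]
  exact TotalSpace.ext (inv_mul_cancel g).symm (heq_of_eq h1.symm)

/-! ### Multiplicative bivectors in the left trivialization -/

theorem isSmoothOneForm_comp_leftDInv (α : E →L[ℝ] ℝ) :
    IsSmoothOneForm 𝓘(ℝ, E) (M := G) fun g => α.comp (leftDInv E g) := fun _ hX =>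
  α.contMDiff.comp (contMDiff_leftDInv_apply hX)

variable {P : ∀ g : G, Tensor2 (TangentSpace 𝓘(ℝ, E) g)}

theorem contMDiff_leftTrivialization [FiniteDimensional ℝ E] (hP : IsPoisson 𝓘(ℝ, E) P) :
    ContMDiff 𝓘(ℝ, E) 𝓘(ℝ, Tensor2 E) ∞ (leftTrivialization 𝓘(ℝ, E) P) :=
  contMDiff_clm_of_apply fun α => contMDiff_clm_of_apply fun β =>
    hP.smooth _ _ (isSmoothOneForm_comp_leftDInv α) (isSmoothOneForm_comp_leftDInv β)

theorem leftDInv_mul_comp_mul_left (g k : G) :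
    (leftDInv E (g * k)).comp (modelDeriv E E (fun x : G => g * x) k) = leftDInv E k := by
  rw [leftDInv, ← modelDeriv_comp (mdifferentiableAt_mul_left (E := E) (g * k)⁻¹ (g * k))
    (f := fun x : G => g * x) (mdifferentiableAt_mul_left (E := E) g k), leftDInv]
  congr 1
  funext x
  group

/-- This differentiates `(g k)⁻¹ (x k) = k⁻¹ (g⁻¹ x) k`: a right translation, seen in the left
trivialization, is an adjoint action. -/
theorem leftDInv_mul_comp_mul_right (g k : G) :
    (leftDInv E (g * k)).comp (modelDeriv E E (fun x : G => x * k) g)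
      = (adjoint E k⁻¹).comp (leftDInv E g) := by
  rw [leftDInv, ← modelDeriv_comp (mdifferentiableAt_mul_left (E := E) (g * k)⁻¹ (g * k))
    (f := fun x : G => x * k) (mdifferentiableAt_mul_right (E := E) k g), leftDInv, adjoint,
    ← modelDeriv_comp_of_eq (mdifferentiableAt_conj (E := E) k⁻¹ 1)
    (mdifferentiableAt_mul_left (E := E) g⁻¹ g) (inv_mul_cancel g)]
  congr 1
  funext x
  group

theorem leftTrivialization_mul (hP : IsPoissonLie 𝓘(ℝ, E) P) (g k : G) (α β : E →L[ℝ] ℝ) :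
    leftTrivialization 𝓘(ℝ, E) P (g * k) α β
      = leftTrivialization 𝓘(ℝ, E) P k α β
        + leftTrivialization 𝓘(ℝ, E) P g (α.comp (adjoint E k⁻¹)) (β.comp (adjoint E k⁻¹)) := by
  have h1 : ∀ γ : E →L[ℝ] ℝ, (γ.comp (leftDInv E (g * k))).comp
      (modelDeriv E E (fun x : G => g * x) k) = γ.comp (leftDInv E k) := fun γ => by
    rw [ContinuousLinearMap.comp_assoc, leftDInv_mul_comp_mul_left]
  have h2 : ∀ γ : E →L[ℝ] ℝ, (γ.comp (leftDInv E (g * k))).comp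
      (modelDeriv E E (fun x : G => x * k) g)
        = (γ.comp (adjoint E k⁻¹)).comp (leftDInv E g) := fun γ => by
    rw [ContinuousLinearMap.comp_assoc, leftDInv_mul_comp_mul_right,
      ContinuousLinearMap.comp_assoc]
  have h := congrArg (fun Q => Q (α.comp (leftDInv E (g * k))) (β.comp (leftDInv E (g * k))))
    (hP.mult g k)
  refine h.trans ?_
  have h3 := congrArg₂ (fun a b => (P k : Tensor2 E) a b) (h1 α) (h1 β)
  have h4 := congrArg₂ (fun a b => (P g : Tensor2 E) a b) (h2 α) (h2 β)
  exact congrArg₂ (· + ·) h3 h4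

theorem leftTrivialization_one (hP : IsPoissonLie 𝓘(ℝ, E) P) (α β : E →L[ℝ] ℝ) :
    leftTrivialization 𝓘(ℝ, E) P 1 α β = 0 := by
  have h := leftTrivialization_mul hP 1 1 α β
  rw [mul_one, inv_one, adjoint_one] at h
  exact left_eq_add.1 h

theorem modelDeriv_clm_apply_apply {A : M → Tensor2 E} {x : M}
    (hA : MDifferentiableAt 𝓘(ℝ, E) 𝓘(ℝ, Tensor2 E) A x) (α β : E →L[ℝ] ℝ) (v : E) :
    modelDeriv E ℝ (fun y => A y α β) x v = modelDeriv E (Tensor2 E) A x v α β := by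
  rw [modelDeriv_clm_apply (mdifferentiableAt_clm_apply hA mdifferentiableAt_const)
    mdifferentiableAt_const, modelDeriv_clm_apply hA mdifferentiableAt_const, modelDeriv_const,
    modelDeriv_const]
  simp

/-- The left factor of the product is varied: by multiplicativity `Q (k g)` is a constant plus the
`Ad_{g⁻¹}`-image of `Q k`, whose derivative at `k = 1` is the cocycle. Passing from this derivative
to `leftDeriv` turns `v` into `Ad_g v`. -/
theorem leftDeriv_leftTrivialization [FiniteDimensional ℝ E] (hP : IsPoissonLie 𝓘(ℝ, E) P)
    (g : G) (v : E) (α β : E →L[ℝ] ℝ) :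
    leftDeriv E (leftTrivialization 𝓘(ℝ, E) P) g v α β
      = cocycle 𝓘(ℝ, E) P (adjoint E g v) (α.comp (adjoint E g⁻¹)) (β.comp (adjoint E g⁻¹)) := by
  set Q := leftTrivialization 𝓘(ℝ, E) P
  have hQ : ∀ k, MDifferentiableAt 𝓘(ℝ, E) 𝓘(ℝ, Tensor2 E) Q k := fun k =>
    (contMDiff_leftTrivialization hP.toIsPoisson).contMDiffAt.mdifferentiableAt (by simp)
  have hQ' : ∀ k α β, MDifferentiableAt 𝓘(ℝ, E) 𝓘(ℝ, ℝ) (fun k => Q k α β) k := fun k α β =>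
    mdifferentiableAt_clm_apply (mdifferentiableAt_clm_apply (hQ k) mdifferentiableAt_const)
      mdifferentiableAt_const
  have h1 : leftDeriv E Q g v α β = leftDeriv E (fun k => Q k α β) g v :=
    (modelDeriv_clm_apply_apply (mdifferentiableAt_comp_mul_left (hQ g)) α β v).symm
  rw [h1, leftDeriv_eq_rightDeriv (hQ' g α β), ContinuousLinearMap.comp_apply]
  have h2 : (fun k => Q (k * g) α β)
      = fun k => Q g α β + Q k (α.comp (adjoint E g⁻¹)) (β.comp (adjoint E g⁻¹)) := by
    funext k
    exact leftTrivialization_mul hP k g α β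
  rw [h2, modelDeriv_add mdifferentiableAt_const (hQ' 1 _ _), modelDeriv_const, zero_add,
    modelDeriv_clm_apply_apply (hQ 1)]
  rfl

/-- The right factor is varied instead. Evaluating `Q (g k)` on covectors composed with `Ad_k`
cancels the twist by `Ad_{k⁻¹}`, so the term with `Q g` is constant in `k`. The product rule at `k =
1` then gives the `ad` terms for `Q g`, while those for `Q k` vanish because `Q 1 = 0`. -/
theorem leftDeriv_leftTrivialization_add [FiniteDimensional ℝ E] (hP : IsPoissonLie 𝓘(ℝ, E) P)
    (g : G) (v : E) (α β : E →L[ℝ] ℝ) :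
    leftDeriv E (leftTrivialization 𝓘(ℝ, E) P) g v α β
      + leftTrivialization 𝓘(ℝ, E) P g (α.comp (adBracket E G v)) β
      + leftTrivialization 𝓘(ℝ, E) P g α (β.comp (adBracket E G v))
      = cocycle 𝓘(ℝ, E) P v α β := by
  set Q := leftTrivialization 𝓘(ℝ, E) P
  have hQ : ∀ k, MDifferentiableAt 𝓘(ℝ, E) 𝓘(ℝ, Tensor2 E) Q k := fun k =>
    (contMDiff_leftTrivialization hP.toIsPoisson).contMDiffAt.mdifferentiableAt (by simp)
  have had : MDifferentiableAt 𝓘(ℝ, E) 𝓘(ℝ, E →L[ℝ] E) (adjoint E : G → E →L[ℝ] E) 1 :=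
    (contMDiffAt_adjoint 1).mdifferentiableAt (by simp)
  have hc : ∀ γ : E →L[ℝ] ℝ, MDifferentiableAt 𝓘(ℝ, E) 𝓘(ℝ, E →L[ℝ] ℝ)
      (fun k : G => γ.comp (adjoint E k)) 1 := fun γ =>
    (ContinuousLinearMap.compL ℝ E E ℝ γ).differentiableAt.comp_mdifferentiableAt had
  have hc' : ∀ γ : E →L[ℝ] ℝ, modelDeriv E (E →L[ℝ] ℝ) (fun k : G => γ.comp (adjoint E k)) 1 v
      = γ.comp (adBracket E G v) := fun γ => by
    have := modelDeriv_clm_comp (ContinuousLinearMap.compL ℝ E E ℝ γ) had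
    exact congrArg (fun L : E →L[ℝ] (E →L[ℝ] ℝ) => L v) this
  have hid : ∀ γ : E →L[ℝ] ℝ, γ.comp (adjoint E (1 : G)) = γ := fun γ => by
    rw [adjoint_one, ContinuousLinearMap.comp_id]
  have key : ∀ A : G → Tensor2 E, MDifferentiableAt 𝓘(ℝ, E) 𝓘(ℝ, Tensor2 E) A 1 →
      modelDeriv E ℝ (fun k => A k (α.comp (adjoint E k)) (β.comp (adjoint E k))) 1 v
        = modelDeriv E (Tensor2 E) A 1 v α β + A 1 (α.comp (adBracket E G v)) β
          + A 1 α (β.comp (adBracket E G v)) := by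
    intro A hA
    rw [modelDeriv_clm_apply (mdifferentiableAt_clm_apply hA (hc α)) (hc β),
      modelDeriv_clm_apply hA (hc α), hc', hc', hid, hid, add_apply]
  have h1 : (fun k => Q (g * k) (α.comp (adjoint E k)) (β.comp (adjoint E k)))
      = fun k => Q g α β + Q k (α.comp (adjoint E k)) (β.comp (adjoint E k)) := by
    funext k
    have hk : ∀ γ : E →L[ℝ] ℝ, (γ.comp (adjoint E k)).comp (adjoint E k⁻¹) = γ := fun γ => by
      ext w
      simp only [ContinuousLinearMap.comp_apply, adjoint_adjoint_inv]
    rw [leftTrivialization_mul hP g k, hk, hk, add_comm]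
  have h2 := key (fun k => Q (g * k)) (mdifferentiableAt_comp_mul_left (hQ g))
  rw [h1, modelDeriv_add mdifferentiableAt_const
    (mdifferentiableAt_clm_apply (mdifferentiableAt_clm_apply (hQ 1) (hc α)) (hc β)),
    modelDeriv_const, zero_add, key Q (hQ 1), leftTrivialization_one hP,
    leftTrivialization_one hP, add_zero, add_zero] at h2
  simp only [mul_one] at h2
  exact h2.symm

end Smoothness

/-! ### Traces, determinants and the pointwise divergence computation -/

section TraceAndDeterminant

variable {E : Type*} [NormedAddCommGroup E] [NormedSpace ℝ E]

theorem trace_eq_sum_coord {ι : Type*} [Fintype ι] (b : Module.Basis ι ℝ E) (B : E →ₗ[ℝ] E) :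
    LinearMap.trace ℝ E B = ∑ i, b.coord i (B (b i)) := by
  classical
  rw [LinearMap.trace_eq_matrix_trace ℝ b, Matrix.trace]
  simp [LinearMap.toMatrix_apply]

variable [FiniteDimensional ℝ E]

/-- The coordinate functionals of a basis, as continuous linear maps. -/
def coordL {ι : Type*} (b : Module.Basis ι ℝ E) (i : ι) : E →L[ℝ] ℝ :=
  LinearMap.toContinuousLinearMap (b.coord i)

theorem coordL_apply {ι : Type*} (b : Module.Basis ι ℝ E) (i : ι) (v : E) :
    coordL b i v = b.repr v i := rfl

theorem sum_apply_smul_coordL {ι : Type*} [Fintype ι] (b : Module.Basis ι ℝ E) (α : E →L[ℝ] ℝ) :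
    ∑ i, α (b i) • coordL b i = α := by
  ext v
  conv_rhs => rw [← b.sum_repr v, map_sum]
  simp [coordL_apply, mul_comm]

theorem trace_dual_eq_sum {ι : Type*} [Fintype ι] (b : Module.Basis ι ℝ E)
    (T : (E →L[ℝ] ℝ) →ₗ[ℝ] (E →L[ℝ] ℝ)) :
    LinearMap.trace ℝ (E →L[ℝ] ℝ) T = ∑ i, T (coordL b i) (b i) := by
  classical
  let b' : Module.Basis ι ℝ (E →L[ℝ] ℝ) := b.dualBasis.map LinearMap.toContinuousLinearMap
  have h1 : ∀ i, b' i = coordL b i := fun i => by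
    simp [b', coordL]
  have h2 : ∀ α i, b'.repr α i = α (b i) := fun α i => by
    simp [b', Module.Basis.map_repr]
  rw [LinearMap.trace_eq_matrix_trace ℝ b', Matrix.trace]
  simp [LinearMap.toMatrix_apply, h1, h2]

section Alternating

/-- An alternating form on a finite-dimensional space, as a continuous multilinear map. -/
def formL (ν : E [⋀^Fin (Module.finrank ℝ E)]→ₗ[ℝ] ℝ) : ContinuousMultilinearMap ℝ (fun _ : Fin (Module.finrank ℝ E) => E) ℝ :=
  { ν.toMultilinearMap with
    cont := by
      change Continuous fun v => ν v
      rw [ν.eq_smul_basis_det (Module.finBasis ℝ E)]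
      refine continuous_const.mul (Continuous.matrix_det ?_)
      exact continuous_matrix fun i j =>
        (coordL (Module.finBasis ℝ E) i).continuous.comp (continuous_apply j) }

theorem hasFDerivAt_form (ν : E [⋀^Fin (Module.finrank ℝ E)]→ₗ[ℝ] ℝ) (v : Fin (Module.finrank ℝ E) → E) :
    HasFDerivAt (fun w => ν w) ((formL ν).linearDeriv v) v :=
  (formL ν).hasFDerivAt v

theorem form_comp_eq_det (ν : E [⋀^Fin (Module.finrank ℝ E)]→ₗ[ℝ] ℝ)
    (A : E →L[ℝ] E) (v : Fin (Module.finrank ℝ E) → E) :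
    ν (fun i => A (v i)) = LinearMap.det (A : E →ₗ[ℝ] E) * ν v := by
  rw [ν.eq_smul_basis_det (Module.finBasis ℝ E)]
  have h := (Module.finBasis ℝ E).det_comp (A : E →ₗ[ℝ] E) v
  simp only [AlternatingMap.smul_apply, smul_eq_mul]
  rw [← mul_left_comm, ← h]
  rfl

theorem hasFDerivAt_form_comp (ν : E [⋀^Fin (Module.finrank ℝ E)]→ₗ[ℝ] ℝ) (v : Fin (Module.finrank ℝ E) → E) :
    ∃ D : (E →L[ℝ] E) →L[ℝ] ℝ,
      HasFDerivAt (fun A : E →L[ℝ] E => ν fun i => A (v i)) D (ContinuousLinearMap.id ℝ E) ∧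
      ∀ B : E →L[ℝ] E, D B = ∑ i, ν (Function.update v i (B (v i))) := by
  let ev : (E →L[ℝ] E) →L[ℝ] (Fin (Module.finrank ℝ E) → E) :=
    ContinuousLinearMap.pi fun i => ContinuousLinearMap.apply ℝ E (v i)
  refine ⟨_, (hasFDerivAt_form ν (ev (ContinuousLinearMap.id ℝ E))).comp
    (ContinuousLinearMap.id ℝ E) ev.hasFDerivAt, fun B => ?_⟩
  rw [ContinuousLinearMap.comp_apply, ContinuousMultilinearMap.linearDeriv_apply]
  rfl

/-- The determinant of `A` is the value of `b.det` on the images under `A` of the basis `b`.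
Replacing `b i` by `B (b i)` in `b.det` leaves only the `i`-th diagonal coefficient of `B`. -/
theorem hasFDerivAt_det_id : ∃ D : (E →L[ℝ] E) →L[ℝ] ℝ,
    HasFDerivAt (fun A : E →L[ℝ] E => LinearMap.det (A : E →ₗ[ℝ] E)) D
      (ContinuousLinearMap.id ℝ E) ∧
    ∀ B : E →L[ℝ] E, D B = LinearMap.trace ℝ E (B : E →ₗ[ℝ] E) := by
  let b := Module.finBasis ℝ E
  obtain ⟨D, hD, hD'⟩ := hasFDerivAt_form_comp b.det b
  refine ⟨D, ?_, fun B => ?_⟩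
  · refine hD.congr_of_eventuallyEq (Filter.Eventually.of_forall fun A => ?_)
    refine Eq.trans ?_ (form_comp_eq_det b.det A b).symm
    rw [b.det_self, mul_one]
  · rw [hD', trace_eq_sum_coord b]
    refine Finset.sum_congr rfl fun i _ => ?_
    have h := b.det.toMultilinearMap.map_update_sum (Finset.univ) i
      (fun j => b.repr (B (b i)) j • b j) b
    rw [b.sum_repr] at h
    refine h.trans ?_
    rw [Finset.sum_eq_single i]
    · simp [b.det_self]
    · intro j _ hj
      have h1 := b.det.map_update_self b (Ne.symm hj)
      simp [h1]
    · simp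

/-- The two sides are the derivatives at the identity, in direction `B`, of the two sides of
`form_comp_eq_det`. -/
theorem sum_form_update (ν : E [⋀^Fin (Module.finrank ℝ E)]→ₗ[ℝ] ℝ) (B : E →L[ℝ] E)
    (v : Fin (Module.finrank ℝ E) → E) :
    ∑ i, ν (Function.update v i (B (v i))) = LinearMap.trace ℝ E (B : E →ₗ[ℝ] E) * ν v := by
  obtain ⟨D, hD, hD'⟩ := hasFDerivAt_form_comp ν v
  obtain ⟨D₁, hD₁, hD₁'⟩ := hasFDerivAt_det_id (E := E)
  have h := hD₁.mul_const (ν v)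
  have h' := hD.unique (h.congr_of_eventuallyEq
    (Filter.Eventually.of_forall fun A => form_comp_eq_det ν A v))
  rw [← hD', ← hD₁', h']
  simp [mul_comm]

theorem det_exteriorPower_map (A : E →L[ℝ] E) :
    LinearMap.det (exteriorPower.map (Module.finrank ℝ E) (A : E →ₗ[ℝ] E))
      = LinearMap.det (A : E →ₗ[ℝ] E) := by
  have h1 : exteriorPower.map (Module.finrank ℝ E) (A : E →ₗ[ℝ] E)
      = LinearMap.det (A : E →ₗ[ℝ] E) • LinearMap.id := by
    refine exteriorPower.linearMap_ext ?_
    refine AlternatingMap.ext fun v => ?_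
    rw [← sub_eq_zero, ← Module.forall_dual_apply_eq_zero_iff ℝ]
    intro ℓ
    have h := form_comp_eq_det (ℓ.compAlternatingMap (exteriorPower.ιMulti ℝ _)) A v
    simp only [map_sub, LinearMap.compAlternatingMap_apply, exteriorPower.map_apply_ιMulti,
      LinearMap.smul_apply, LinearMap.id_apply, map_smul, smul_eq_mul] at h ⊢
    rw [← h]
    exact sub_self _
  -- The top exterior power is a line, so the determinant of the scalar map is the scalar to the
  -- power one.
  rw [h1, LinearMap.det_smul, exteriorPower.finrank_eq, Nat.choose_self, pow_one, LinearMap.det_id,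
    mul_one]

end Alternating

/-- Contraction with the skew tensor `Q` retains only the antisymmetric part of `S`, which is half
of `h ∘ c`. -/
theorem sum_contraction {ι : Type*} [Fintype ι] (b : Module.Basis ι ℝ E) {Q : Tensor2 E}
    (hQ : ∀ α β, Q α β = -Q β α) {S : E →L[ℝ] E →L[ℝ] ℝ} {h : E →L[ℝ] ℝ}
    {c : E →L[ℝ] E →L[ℝ] E} (hS : ∀ v w, S v w - S w v = h (c v w)) :
    ∑ j, Q (S (b j)) (coordL b j) = 1 / 2 * ∑ j, Q (h.comp (c (b j))) (coordL b j) := by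
  have hexp : ∀ (α : E →L[ℝ] ℝ) j, Q α (coordL b j)
      = ∑ i, α (b i) * Q (coordL b i) (coordL b j) := by
    intro α j
    conv_lhs => rw [← sum_apply_smul_coordL b α, map_sum]
    simp
  have h1 : ∑ j, ∑ i, S (b j) (b i) * Q (coordL b i) (coordL b j)
      = -∑ j, ∑ i, S (b i) (b j) * Q (coordL b i) (coordL b j) := by
    rw [Finset.sum_comm, ← Finset.sum_neg_distrib]
    refine Finset.sum_congr rfl fun i _ => ?_
    rw [← Finset.sum_neg_distrib]
    refine Finset.sum_congr rfl fun j _ => ?_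
    rw [hQ (coordL b i) (coordL b j)]
    ring
  have h2 : ∑ j, Q (h.comp (c (b j))) (coordL b j)
      = ∑ j, ∑ i, S (b j) (b i) * Q (coordL b i) (coordL b j)
        - ∑ j, ∑ i, S (b i) (b j) * Q (coordL b i) (coordL b j) := by
    rw [← Finset.sum_sub_distrib]
    refine Finset.sum_congr rfl fun j _ => ?_
    rw [hexp, ← Finset.sum_sub_distrib]
    refine Finset.sum_congr rfl fun i _ => ?_
    rw [ContinuousLinearMap.comp_apply, ← hS, sub_mul]
  rw [h2]
  rw [Finset.sum_congr rfl fun j _ => hexp (S (b j)) j]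
  linarith

/-- The divergence of a Hamiltonian vector field, in terms of pointwise data. -/
theorem trace_hamiltonian {Q : Tensor2 E} (hQ : ∀ α β, Q α β = -Q β α)
    {D δ : E →L[ℝ] Tensor2 E} {S : E →L[ℝ] E →L[ℝ] ℝ} {h : E →L[ℝ] ℝ}
    {c : E →L[ℝ] E →L[ℝ] E} (hS : ∀ v w, S v w - S w v = h (c v w))
    (hc : ∀ v w, c v w = -c w v) (A : E ≃ₗ[ℝ] E)
    (hD : ∀ v α β, D v α β = δ (A v) (α.comp (LinearMap.toContinuousLinearMap A.symm.toLinearMap))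
      (β.comp (LinearMap.toContinuousLinearMap A.symm.toLinearMap)))
    (hD' : ∀ v α β, D v α β + Q (α.comp (c v)) β + Q α (β.comp (c v)) = δ v α β)
    {m : E} (hm : ∀ (b : Module.Basis (Fin (Module.finrank ℝ E)) ℝ E) (α : E →L[ℝ] ℝ),
      α m = ∑ j, δ (b j) α (coordL b j))
    {x : E} (hx : ∀ β : E →L[ℝ] ℝ, β x = Q h β) {L : E →L[ℝ] E}
    (hL : ∀ (v : E) (β : E →L[ℝ] ℝ), β (L v) = D v h β + Q (S v) β) :
    LinearMap.trace ℝ E (L : E →ₗ[ℝ] E)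
      = 1 / 2 * (h m + h (A.symm m)) + 1 / 2 * LinearMap.trace ℝ E (c x : E →ₗ[ℝ] E) := by
  let b := Module.finBasis ℝ E
  have h1 : LinearMap.trace ℝ E (L : E →ₗ[ℝ] E)
      = ∑ j, D (b j) h (coordL b j) + ∑ j, Q (S (b j)) (coordL b j) := by
    rw [trace_eq_sum_coord b, ← Finset.sum_add_distrib]
    exact Finset.sum_congr rfl fun j _ => hL (b j) (coordL b j)
  have h2 : ∑ j, D (b j) h (coordL b j) = h (A.symm m) := by
    -- The functionals `coordL b j ∘ A⁻¹` are dual to the basis `A (b j)`, so `hD` turns the sum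
    -- into the formula for `m` in that basis.
    have h3 := hm (b.map A) (h.comp (LinearMap.toContinuousLinearMap A.symm.toLinearMap))
    refine Eq.trans (Finset.sum_congr rfl fun j _ => ?_) h3.symm
    rw [hD, Module.Basis.map_apply]
    rfl
  -- The same sum by `hD'`. The `ad` term in the second slot of `Q` is a pairing with `x`, and
  -- skewness of `c` makes it a trace.
  have h3 : ∑ j, D (b j) h (coordL b j) = h m - ∑ j, Q (h.comp (c (b j))) (coordL b j)
      + LinearMap.trace ℝ E (c x : E →ₗ[ℝ] E) := by
    rw [hm b h, trace_eq_sum_coord b, ← Finset.sum_sub_distrib, ← Finset.sum_add_distrib]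
    refine Finset.sum_congr rfl fun j _ => ?_
    have h4 : Q h ((coordL b j).comp (c (b j))) = -b.coord j (c x (b j)) := by
      rw [← hx, ContinuousLinearMap.comp_apply, hc, map_neg]
      rfl
    have h5 := hD' (b j) h (coordL b j)
    rw [h4] at h5
    have h6 : b.coord j ((c x : E →ₗ[ℝ] E) (b j)) = b.coord j (c x (b j)) := rfl
    rw [h6]
    linarith
  -- The mean of `h2` and `h3` contains minus half of the contraction of `Q` with `h ∘ c`, which
  -- this term cancels.
  have h4 := sum_contraction b hQ hS
  rw [h1, h4]
  linarith

end TraceAndDeterminant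

/-! ### The Lie derivative of a multiple of a left-invariant volume form -/

section Divergence

open Filter Topology

variable {E : Type*} [NormedAddCommGroup E] [NormedSpace ℝ E] [FiniteDimensional ℝ E]
  {G : Type*} [TopologicalSpace G] [ChartedSpace E G]

theorem contDiff_form (ν : E [⋀^Fin (Module.finrank ℝ E)]→ₗ[ℝ] ℝ) :
    ContDiff ℝ ∞ fun v => ν v :=
  (formL ν).contDiff

theorem contMDiff_form_apply (ν : E [⋀^Fin (Module.finrank ℝ E)]→ₗ[ℝ] ℝ)
    {y : Fin (Module.finrank ℝ E) → G → E} (hy : ∀ i, ContMDiff 𝓘(ℝ, E) 𝓘(ℝ, E) ∞ (y i)) :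
    ContMDiff 𝓘(ℝ, E) 𝓘(ℝ, ℝ) ∞ fun g => ν fun i => y i g :=
  (contDiff_form ν).contMDiff.comp (contMDiff_pi_space.2 hy)

theorem modelDeriv_form_apply (ν : E [⋀^Fin (Module.finrank ℝ E)]→ₗ[ℝ] ℝ)
    {y : Fin (Module.finrank ℝ E) → G → E} {g : G}
    (hy : ∀ i, ContMDiff 𝓘(ℝ, E) 𝓘(ℝ, E) ∞ (y i)) (v : E) :
    modelDeriv E ℝ (fun g => ν fun i => y i g) g v
      = ∑ i, ν (Function.update (fun j => y j g) i (modelDeriv E E (y i) g v)) := by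
  have hp : MDifferentiableAt 𝓘(ℝ, E) 𝓘(ℝ, Fin (Module.finrank ℝ E) → E)
      (fun g i => y i g) g := 
    (contMDiff_pi_space.2 hy).contMDiffAt.mdifferentiableAt (by simp)
  have h1 : ∀ i, modelDeriv E (Fin (Module.finrank ℝ E) → E) (fun g i => y i g) g v i
      = modelDeriv E E (y i) g v := fun i => by
    have := modelDeriv_clm_comp (ContinuousLinearMap.proj (R := ℝ)
      (φ := fun _ : Fin (Module.finrank ℝ E) => E) i) hp
    exact (congrArg (fun L : E →L[ℝ] E => L v) this).symm
  rw [modelDeriv_fderiv_comp (g := fun w => ν w) (hasFDerivAt_form ν _).differentiableAt hp,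
    (hasFDerivAt_form ν _).fderiv, ContinuousLinearMap.comp_apply,
    ContinuousMultilinearMap.linearDeriv_apply]
  refine Finset.sum_congr rfl fun i _ => ?_
  rw [h1]
  rfl

variable [Group G] [LieGroup 𝓘(ℝ, E) ∞ G]

/-- The divergence, with respect to the left-invariant volume forms, of the vector field whose left
trivialization is `x`. -/
def leftDivergence (x : G → E) (g : G) : ℝ :=
  LinearMap.trace ℝ E (leftDeriv E x g : E →ₗ[ℝ] E)
    - LinearMap.trace ℝ E (adBracket E G (x g) : E →ₗ[ℝ] E)

theorem lieDerivative_smul_leftForm {X : G → E} (hX : IsSmoothField 𝓘(ℝ, E) (M := G) X)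
    {φ : G → ℝ} (hφ : IsSmoothFun 𝓘(ℝ, E) φ) (ν : E [⋀^Fin (Module.finrank ℝ E)]→ₗ[ℝ] ℝ)
    {Y : Fin (Module.finrank ℝ E) → G → E} (hY : ∀ i, IsSmoothField 𝓘(ℝ, E) (M := G) (Y i))
    (g : G) :
    lieDerivative 𝓘(ℝ, E) (M := G) X (fun g => φ g • leftForm 𝓘(ℝ, E) ν g) Y g
      = (derivAlong 𝓘(ℝ, E) (M := G) X φ g
          + φ g * leftDivergence (fun k => leftDInv E k (X k)) g)
        * ν (fun i => leftDInv E g (Y i g)) := by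
  set x : G → E := fun k => leftDInv E k (X k)
  set y : Fin (Module.finrank ℝ E) → G → E := fun i k => leftDInv E k (Y i k)
  have hx : ContMDiff 𝓘(ℝ, E) 𝓘(ℝ, E) ∞ x := contMDiff_leftDInv_apply hX
  have hy : ∀ i, ContMDiff 𝓘(ℝ, E) 𝓘(ℝ, E) ∞ (y i) := fun i => contMDiff_leftDInv_apply (hY i)
  have hx' : MDifferentiableAt 𝓘(ℝ, E) 𝓘(ℝ, E) x g := hx.contMDiffAt.mdifferentiableAt (by simp)
  have hy' : ∀ i, MDifferentiableAt 𝓘(ℝ, E) 𝓘(ℝ, E) (y i) g := fun i =>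
    (hy i).contMDiffAt.mdifferentiableAt (by simp)
  have hφ' : MDifferentiableAt 𝓘(ℝ, E) 𝓘(ℝ, ℝ) φ g :=
    (hφ.contMDiffAt (x := g)).mdifferentiableAt (by simp)
  have hν' : MDifferentiableAt 𝓘(ℝ, E) 𝓘(ℝ, ℝ) (fun k => ν fun i => y i k) g :=
    (contMDiff_form_apply ν hy).contMDiffAt.mdifferentiableAt (by simp)
  have h1 : derivAlong 𝓘(ℝ, E) (M := G) X
      (fun k => (φ k • leftForm 𝓘(ℝ, E) ν k) fun i => Y i k) g
      = derivAlong 𝓘(ℝ, E) (M := G) X φ g * ν (fun i => y i g)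
        + φ g * ∑ i, ν (Function.update (fun j => y j g) i (leftDeriv E (y i) g (x g))) := by
    have h2 : derivAlong 𝓘(ℝ, E) (M := G) X
        (fun k => (φ k • leftForm 𝓘(ℝ, E) ν k) fun i => Y i k) g
        = modelDeriv E ℝ (fun k => ContinuousLinearMap.mul ℝ ℝ (φ k) (ν fun i => y i k)) g (X g) :=
      rfl
    have hm : MDifferentiableAt 𝓘(ℝ, E) 𝓘(ℝ, ℝ →L[ℝ] ℝ)
        (fun k => ContinuousLinearMap.mul ℝ ℝ (φ k)) g :=
      (ContinuousLinearMap.mul ℝ ℝ).differentiableAt.comp_mdifferentiableAt hφ'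
    rw [h2, modelDeriv_clm_apply hm hν', modelDeriv_clm_comp _ hφ', modelDeriv_form_apply ν hy]
    simp only [modelDeriv_eq_leftDeriv (hy' _)]
    rfl
  -- The first term on the right cancels the derivative of `y i` in `h1`. The second is tensorial in
  -- `y i`, and its sum over `i` is a trace.
  have h2 : ∀ i, (φ g • leftForm 𝓘(ℝ, E) ν g) (Function.update (fun j => Y j g) i
      (VectorField.mlieBracket 𝓘(ℝ, E) X (Y i) g))
      = φ g * (ν (Function.update (fun j => y j g) i (leftDeriv E (y i) g (x g)))
        - ν (Function.update (fun j => y j g) i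
          ((leftDeriv E x g - adBracket E G (x g)) (y i g)))) := by
    intro i
    have h3 : (φ g • leftForm 𝓘(ℝ, E) ν g) (Function.update (fun j => Y j g) i
        (VectorField.mlieBracket 𝓘(ℝ, E) X (Y i) g))
        = φ g * ν (fun j => leftDInv E g (Function.update (fun j => Y j g) i
          (VectorField.mlieBracket 𝓘(ℝ, E) X (Y i) g : E) j)) := rfl
    have h4 : (fun j => leftDInv E g (Function.update (fun j => Y j g) i
          (VectorField.mlieBracket 𝓘(ℝ, E) X (Y i) g : E) j))
        = Function.update (fun j => y j g) i
          (leftDInv E g (VectorField.mlieBracket 𝓘(ℝ, E) X (Y i) g : E)) := by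
      funext j
      by_cases hj : j = i
      · subst hj
        rw [Function.update_self]
        exact congrArg (leftDInv E g) (Function.update_self _ _ _)
      · rw [Function.update_of_ne hj]
        exact congrArg (leftDInv E g) (Function.update_of_ne hj _ _)
    have h5 := leftDInv_mlieBracket (X := X) (Y := Y i) (g := g)
      ((hX g).mdifferentiableAt (by simp)) ((hY i g).mdifferentiableAt (by simp)) hx' (hy' i)
    rw [h3, h4, h5, ← AlternatingMap.map_update_sub]
    congr 3
    simp only [sub_apply]
    abel
  have h3 := sum_form_update ν (leftDeriv E x g - adBracket E G (x g)) (fun i => y i g)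
  rw [ContinuousLinearMap.toLinearMap_sub, map_sub] at h3
  refine (congrArg₂ (fun a b : ℝ => a - b) h1 (Finset.sum_congr rfl fun i _ => h2 i)).trans ?_
  rw [← Finset.mul_sum,
    Finset.sum_sub_distrib, h3, leftDivergence]
  ring

end Divergence

/-! ### The divergence of the Hamiltonian field, and the function `f₀` -/

section Hamiltonian

open Filter Topology

variable {E : Type*} [NormedAddCommGroup E] [NormedSpace ℝ E]
  {G : Type*} [TopologicalSpace G] [ChartedSpace E G] [Group G]

/-- A trace may be computed in any basis; `trace_hamiltonian` uses this freedom with a basis moved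
by `Ad_g`. -/
theorem apply_dualModularCharacter [FiniteDimensional ℝ E]
    {P : ∀ g : G, Tensor2 (TangentSpace 𝓘(ℝ, E) g)}
    (b : Module.Basis (Fin (Module.finrank ℝ E)) ℝ E)
    (α : E →L[ℝ] ℝ) :
    α (dualModularCharacter 𝓘(ℝ, E) P : E) = ∑ j, cocycle 𝓘(ℝ, E) P (b j) α (coordL b j) := by
  have h := apply_ofBidual (V := E)
    (LinearMap.trace ℝ (E →L[ℝ] ℝ) ∘ₗ dualBracket 𝓘(ℝ, E) P) α
  refine h.trans ?_
  rw [LinearMap.comp_apply, trace_dual_eq_sum b]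
  rfl

theorem f₀_eq_det [FiniteDimensional ℝ E] (g : G) : f₀ 𝓘(ℝ, E) g = LinearMap.det (adjoint E g : E →ₗ[ℝ] E) :=
  det_exteriorPower_map (adjoint E g)

theorem f₀_one [FiniteDimensional ℝ E] : f₀ 𝓘(ℝ, E) (1 : G) = 1 := by
  rw [f₀_eq_det, adjoint_one]
  exact LinearMap.det_id

variable [LieGroup 𝓘(ℝ, E) ∞ G] {P : ∀ g : G, Tensor2 (TangentSpace 𝓘(ℝ, E) g)} {H : G → ℝ}

theorem contMDiff_leftDeriv (hH : IsSmoothFun 𝓘(ℝ, E) H) :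
    ContMDiff 𝓘(ℝ, E) 𝓘(ℝ, E →L[ℝ] ℝ) ∞ (leftDeriv E H) := fun g => contMDiffAt_leftDeriv (hH g)

theorem derivAlong_leftField (hH : IsSmoothFun 𝓘(ℝ, E) H) (v : E) (g : G) :
    derivAlong 𝓘(ℝ, E) (leftField 𝓘(ℝ, E) v) H g = leftDeriv E H g v := by
  rw [leftDeriv_eq ((hH g).mdifferentiableAt (by simp))]
  rfl

/-- A right-invariant field has left trivialization `Ad_{g⁻¹} v`. -/
theorem derivAlong_rightField (hH : IsSmoothFun 𝓘(ℝ, E) H) (v : E) (g : G) :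
    derivAlong 𝓘(ℝ, E) (rightField 𝓘(ℝ, E) v) H g = leftDeriv E H g (adjoint E g⁻¹ v) := by
  have hd : MDifferentiableAt 𝓘(ℝ, E) 𝓘(ℝ, ℝ) H g := (hH g).mdifferentiableAt (by simp)
  have h := modelDeriv_comp_of_eq (f := fun k : G => k * g) (x := 1) hd
    (mdifferentiableAt_mul_right (E := E) g 1) (one_mul g)
  rw [leftDeriv_eq_rightDeriv hd, ContinuousLinearMap.comp_apply, adjoint_adjoint_inv, h]
  rfl

variable [FiniteDimensional ℝ E]

variable (P H) in
/-- The left trivialization of the Hamiltonian vector field. -/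
def leftHamiltonian (g : G) : E := leftDInv E g (hamiltonianField 𝓘(ℝ, E) P H g)

theorem apply_leftHamiltonian (hH : IsSmoothFun 𝓘(ℝ, E) H) (g : G) (β : E →L[ℝ] ℝ) :
    β (leftHamiltonian P H g) = leftTrivialization 𝓘(ℝ, E) P g (leftDeriv E H g) β := by
  have h1 : modelDeriv E ℝ H g = (leftDeriv E H g).comp (leftDInv E g) := by
    ext v
    exact modelDeriv_eq_leftDeriv ((hH g).mdifferentiableAt (by simp)) v
  have h2 : β (leftHamiltonian P H g)
      = (P g : Tensor2 E) (modelDeriv E ℝ H g) (β.comp (leftDInv E g)) :=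
    apply_ofBidual (V := TangentSpace 𝓘(ℝ, E) g) (P g (modelDeriv E ℝ H g)).toLinearMap
      (β.comp (leftDInv E g))
  rw [h2, h1]
  rfl

theorem contMDiff_leftHamiltonian (hP : IsPoisson 𝓘(ℝ, E) P) (hH : IsSmoothFun 𝓘(ℝ, E) H) :
    ContMDiff 𝓘(ℝ, E) 𝓘(ℝ, E) ∞ (leftHamiltonian P H) := by
  refine contMDiff_of_dual_apply fun β => ?_
  simp only [apply_leftHamiltonian hH]
  exact ((contMDiff_leftTrivialization hP).clm_apply (contMDiff_leftDeriv hH)).clm_apply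
    contMDiff_const

theorem isSmoothField_hamiltonianField (hP : IsPoisson 𝓘(ℝ, E) P) (hH : IsSmoothFun 𝓘(ℝ, E) H) :
    IsSmoothField 𝓘(ℝ, E) (hamiltonianField 𝓘(ℝ, E) P H) := by
  have h : hamiltonianField 𝓘(ℝ, E) P H
      = fun g => (leftD E g (leftHamiltonian P H g) : E) := by
    funext g
    exact (leftD_leftDInv (E := E) g (hamiltonianField 𝓘(ℝ, E) P H g)).symm
  rw [h]
  exact isSmoothField_leftD_apply (contMDiff_leftHamiltonian hP hH)

theorem apply_leftDeriv_leftHamiltonian (hP : IsPoisson 𝓘(ℝ, E) P) (hH : IsSmoothFun 𝓘(ℝ, E) H)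
    (g : G) (v : E) (β : E →L[ℝ] ℝ) :
    β (leftDeriv E (leftHamiltonian P H) g v)
      = leftDeriv E (leftTrivialization 𝓘(ℝ, E) P) g v (leftDeriv E H g) β
        + leftTrivialization 𝓘(ℝ, E) P g (leftDeriv E (leftDeriv E H) g v) β := by
  have hx := ((contMDiff_leftHamiltonian hP hH) g).mdifferentiableAt (by simp)
  have hQ := ((contMDiff_leftTrivialization hP) g).mdifferentiableAt (by simp)
  have hh := ((contMDiff_leftDeriv hH) g).mdifferentiableAt (by simp)
  have h1 : β (leftDeriv E (leftHamiltonian P H) g v)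
      = leftDeriv E (fun k => β (leftHamiltonian P H k)) g v :=
    (congrArg (fun L : E →L[ℝ] ℝ => L v)
      (modelDeriv_clm_comp β (mdifferentiableAt_comp_mul_left hx))).symm
  have h0 : leftDeriv E (fun _ : G => β) g v = 0 := by
    rw [leftDeriv, modelDeriv_const, zero_apply]
  rw [h1]
  simp only [apply_leftHamiltonian hH]
  rw [leftDeriv_clm_apply (mdifferentiableAt_clm_apply hQ hh) mdifferentiableAt_const,
    leftDeriv_clm_apply hQ hh, h0, map_zero, add_zero, add_apply]

variable (E) in
/-- The adjoint action as a linear equivalence. -/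
def adjointEquiv (g : G) : E ≃ₗ[ℝ] E :=
  LinearEquiv.ofLinearMap (adjoint E g) (adjoint E g⁻¹)
    (LinearMap.ext (adjoint_adjoint_inv g)) (LinearMap.ext (adjoint_inv_adjoint g))

/-- The derivative of the trivialized field contributes `+½ tr ad` and the definition of
`leftDivergence` contributes `-tr ad`; the remaining `-½ tr ad` is what `log √f₀` accounts for. -/
theorem leftDivergence_leftHamiltonian (hP : IsPoissonLie 𝓘(ℝ, E) P)
    (hH : IsSmoothFun 𝓘(ℝ, E) H) (g : G) :
    leftDivergence (leftHamiltonian P H) g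
      = 1 / 2 * (leftDeriv E H g (dualModularCharacter 𝓘(ℝ, E) P)
          + leftDeriv E H g (adjoint E g⁻¹ (dualModularCharacter 𝓘(ℝ, E) P)))
        - 1 / 2 * LinearMap.trace ℝ E (adBracket E G (leftHamiltonian P H g) : E →ₗ[ℝ] E) := by
  have h := trace_hamiltonian (Q := leftTrivialization 𝓘(ℝ, E) P g)
    (D := leftDeriv E (leftTrivialization 𝓘(ℝ, E) P) g) (δ := cocycle 𝓘(ℝ, E) P)
    (S := leftDeriv E (leftDeriv E H) g) (h := leftDeriv E H g) (c := adBracket E G)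
    (fun α β => hP.skew g _ _) (leftDeriv_leftDeriv_sub (hH g)) adBracket_skew (adjointEquiv E g)
    (leftDeriv_leftTrivialization hP g) (leftDeriv_leftTrivialization_add hP g)
    apply_dualModularCharacter (apply_leftHamiltonian hH g)
    (apply_leftDeriv_leftHamiltonian hP.toIsPoisson hH g)
  rw [leftDivergence, h]
  have h1 : (adjointEquiv E g).symm (dualModularCharacter 𝓘(ℝ, E) P)
      = adjoint E g⁻¹ (dualModularCharacter 𝓘(ℝ, E) P) := rfl
  rw [h1]
  ring

/-! ### The determinant of the adjoint action -/

theorem f₀_mul (g k : G) : f₀ 𝓘(ℝ, E) (g * k) = f₀ 𝓘(ℝ, E) g * f₀ 𝓘(ℝ, E) k := by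
  rw [f₀_eq_det, f₀_eq_det, f₀_eq_det, adjoint_mul, ContinuousLinearMap.toLinearMap_comp,
    LinearMap.det_comp]

theorem continuous_f₀ : Continuous (f₀ 𝓘(ℝ, E) : G → ℝ) := by
  have h : (f₀ 𝓘(ℝ, E) : G → ℝ) = fun g => (adjoint E g).det := funext f₀_eq_det
  rw [h]
  exact ContinuousLinearMap.continuous_det.comp
    (continuous_iff_continuousAt.2 fun g => (contMDiffAt_adjoint g).continuousAt)

/-- A nonpositive value would, by connectedness and `f₀ 1 = 1`, force a zero, but `f₀ k` is
invertible with inverse `f₀ k⁻¹`. -/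
theorem f₀_pos [ConnectedSpace G] (g : G) : 0 < f₀ 𝓘(ℝ, E) g := by
  by_contra hg
  obtain ⟨k, hk⟩ := mem_range_of_exists_le_of_exists_ge (continuous_f₀ (E := E) (G := G))
    ⟨g, not_lt.1 hg⟩ ⟨1, by rw [f₀_one]; exact zero_le_one⟩
  have h := f₀_mul (E := E) k k⁻¹
  rw [mul_inv_cancel, f₀_one, hk, zero_mul] at h
  exact one_ne_zero h

theorem mdifferentiableAt_f₀_one : MDifferentiableAt 𝓘(ℝ, E) 𝓘(ℝ, ℝ) (f₀ 𝓘(ℝ, E)) (1 : G) ∧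
    ∀ v : E, modelDeriv E ℝ (f₀ 𝓘(ℝ, E)) (1 : G) v
      = LinearMap.trace ℝ E (adBracket E G v : E →ₗ[ℝ] E) := by
  obtain ⟨D, hD, hD'⟩ := hasFDerivAt_det_id (E := E)
  have h : (f₀ 𝓘(ℝ, E) : G → ℝ) = fun g => LinearMap.det (adjoint E g : E →ₗ[ℝ] E) :=
    funext f₀_eq_det
  have had : MDifferentiableAt 𝓘(ℝ, E) 𝓘(ℝ, E →L[ℝ] E) (adjoint E : G → E →L[ℝ] E) 1 :=
    (contMDiffAt_adjoint 1).mdifferentiableAt (by simp)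
  rw [← adjoint_one (E := E) (G := G)] at hD
  rw [h]
  refine ⟨hD.differentiableAt.comp_mdifferentiableAt had, fun v => ?_⟩
  rw [modelDeriv_fderiv_comp hD.differentiableAt had, hD.fderiv, ContinuousLinearMap.comp_apply,
    hD']
  rfl

theorem log_sqrt_f₀_mul [ConnectedSpace G] (g k : G) :
    Real.log (Real.sqrt (f₀ 𝓘(ℝ, E) (g * k)))
      = Real.log (Real.sqrt (f₀ 𝓘(ℝ, E) g)) + 1 / 2 * Real.log (f₀ 𝓘(ℝ, E) k) := by
  rw [Real.log_sqrt (f₀_pos _).le, Real.log_sqrt (f₀_pos _).le, f₀_mul,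
    Real.log_mul (f₀_pos g).ne' (f₀_pos k).ne']
  ring

/-- Since `f₀` is multiplicative, translation by `g⁻¹` changes its logarithm by a constant, so only
the derivative of the determinant at the identity is needed. -/
theorem modelDeriv_log_sqrt_f₀ [ConnectedSpace G] (g : G) :
    MDifferentiableAt 𝓘(ℝ, E) 𝓘(ℝ, ℝ) (fun k => Real.log (Real.sqrt (f₀ 𝓘(ℝ, E) k))) g ∧
    ∀ v : E, modelDeriv E ℝ (fun k => Real.log (Real.sqrt (f₀ 𝓘(ℝ, E) k))) g v
      = 1 / 2 * LinearMap.trace ℝ E (adBracket E G (leftDInv E g v) : E →ₗ[ℝ] E) := by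
  obtain ⟨h1, h2⟩ := mdifferentiableAt_f₀_one (E := E) (G := G)
  set c₀ := Real.log (Real.sqrt (f₀ 𝓘(ℝ, E) g))
  have hu : HasDerivAt (fun t : ℝ => c₀ + 1 / 2 * Real.log t) (1 / 2) (f₀ 𝓘(ℝ, E) (1 : G)) := by
    rw [f₀_one]
    have h := ((Real.hasDerivAt_log one_ne_zero).const_mul (1 / 2)).const_add c₀
    simpa using h
  have he : (fun k : G => Real.log (Real.sqrt (f₀ 𝓘(ℝ, E) k)))
      = fun k => c₀ + 1 / 2 * Real.log (f₀ 𝓘(ℝ, E) (g⁻¹ * k)) := by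
    funext k
    rw [← log_sqrt_f₀_mul, mul_inv_cancel_left]
  have hm : MDifferentiableAt 𝓘(ℝ, E) 𝓘(ℝ, ℝ)
      (fun k : G => c₀ + 1 / 2 * Real.log (f₀ 𝓘(ℝ, E) k)) 1 :=
    hu.differentiableAt.comp_mdifferentiableAt h1
  have hl : MDifferentiableAt 𝓘(ℝ, E) 𝓘(ℝ, E) (fun x : G => g⁻¹ * x) g :=
    mdifferentiableAt_mul_left g⁻¹ g
  rw [he]
  refine ⟨MDifferentiableAt.comp_of_eq (f := fun x : G => g⁻¹ * x) g hm hl (inv_mul_cancel g), fun v => ?_⟩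
  have h3 := modelDeriv_comp_of_eq hm hl (inv_mul_cancel g)
  have h4 := modelDeriv_fderiv_comp hu.differentiableAt h1
  have h5 : modelDeriv E ℝ (fun k => c₀ + 1 / 2 * Real.log (f₀ 𝓘(ℝ, E) (g⁻¹ * k))) g v
      = modelDeriv E ℝ (fun k : G => c₀ + 1 / 2 * Real.log (f₀ 𝓘(ℝ, E) k)) 1 (leftDInv E g v) :=
    congrArg (fun L : E →L[ℝ] ℝ => L v) h3
  rw [h5, h4, ContinuousLinearMap.comp_apply, h2, hu.hasFDerivAt.fderiv]
  simp [mul_comm]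

end Hamiltonian

/-! ### Invariant volume forms and the equation for `σ` -/

section VolumeForms

variable {E : Type*} [NormedAddCommGroup E] [NormedSpace ℝ E]
  {G : Type*} [TopologicalSpace G] [ChartedSpace E G]

theorem derivAlong_comp {X : G → E} {φ : G → ℝ} (hφ : IsSmoothFun 𝓘(ℝ, E) φ) {u : ℝ → ℝ}
    {u' : ℝ} {g : G} (hu : HasDerivAt u u' (φ g)) :
    derivAlong 𝓘(ℝ, E) (M := G) X (fun k => u (φ k)) g
      = u' * derivAlong 𝓘(ℝ, E) (M := G) X φ g := by
  have h := modelDeriv_fderiv_comp hu.differentiableAt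
    ((hφ g).mdifferentiableAt (by simp) : MDifferentiableAt 𝓘(ℝ, E) 𝓘(ℝ, ℝ) φ g)
  rw [hu.hasFDerivAt.fderiv] at h
  have h1 := congrArg (fun L : E →L[ℝ] ℝ => L (X g)) h
  refine h1.trans ?_
  simp only [ContinuousLinearMap.comp_apply, ContinuousLinearMap.toSpanSingleton_apply,
    smul_eq_mul]
  exact mul_comm _ _

variable [Group G] [LieGroup 𝓘(ℝ, E) ∞ G]

/-- Forms of top degree are a line at each point, and the coefficient is read off on the
left-invariant frame. -/
theorem eq_smul_leftForm (b : Module.Basis (Fin (Module.finrank ℝ E)) ℝ E) (g : G)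
    (θ : TangentSpace 𝓘(ℝ, E) g [⋀^Fin (Module.finrank ℝ E)]→ₗ[ℝ] ℝ) :
    θ = θ (fun i => leftD E g (b i)) • leftForm 𝓘(ℝ, E) (G := G) b.det g := by
  let θ' : E [⋀^Fin (Module.finrank ℝ E)]→ₗ[ℝ] ℝ := θ
  have h : θ' = θ' (fun i => leftD E g (b i)) •
      b.det.compLinearMap (leftDInv E g : E →ₗ[ℝ] E) := by
    have h1 := (θ'.compLinearMap (leftD E g : E →ₗ[ℝ] E)).eq_smul_basis_det b
    refine AlternatingMap.ext fun v => ?_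
    have h2 := congrArg (fun μ => μ fun i => leftDInv E g (v i)) h1
    refine Eq.trans ?_ h2
    refine congrArg θ' (funext fun i => ?_)
    exact (leftD_leftDInv g (v i)).symm
  exact h

variable [FiniteDimensional ℝ E]

theorem isVolumeForm_smul_leftForm {φ : G → ℝ} (hφ : IsSmoothFun 𝓘(ℝ, E) φ)
    (hφ₀ : ∀ g, φ g ≠ 0) {ν : E [⋀^Fin (Module.finrank ℝ E)]→ₗ[ℝ] ℝ} (hν : ν ≠ 0) :
    IsVolumeForm 𝓘(ℝ, E) (fun g : G => φ g • leftForm 𝓘(ℝ, E) ν g) where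
  smooth Y hY :=
    ContMDiff.mul hφ (contMDiff_form_apply ν fun i => contMDiff_leftDInv_apply (hY i))
  ne_zero g h := by
    refine hν (AlternatingMap.ext fun v => ?_)
    have h1 : φ g * ν (fun i => leftDInv E g (leftD E g (v i))) = 0 :=
      congrArg (fun θ : E [⋀^Fin (Module.finrank ℝ E)]→ₗ[ℝ] ℝ => θ fun i => leftD E g (v i)) h
    simp only [leftDInv_leftD] at h1
    exact (mul_eq_zero.1 h1).resolve_left (hφ₀ g)

theorem preserves_smul_leftForm_iff {X : G → E} (hX : IsSmoothField 𝓘(ℝ, E) (M := G) X)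
    {φ : G → ℝ} (hφ : IsSmoothFun 𝓘(ℝ, E) φ)
    {ν : E [⋀^Fin (Module.finrank ℝ E)]→ₗ[ℝ] ℝ} (hν : ν ≠ 0) :
    Preserves 𝓘(ℝ, E) (M := G) X (fun g => φ g • leftForm 𝓘(ℝ, E) ν g) ↔
      ∀ g, derivAlong 𝓘(ℝ, E) (M := G) X φ g
        + φ g * leftDivergence (fun k => leftDInv E k (X k)) g = 0 := by
  constructor
  · intro h g
    obtain ⟨v, hv⟩ : ∃ v, ν v ≠ 0 := by
      by_contra! hc
      exact hν (AlternatingMap.ext hc)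
    -- Left-invariant fields through a tuple with `ν v ≠ 0` suffice as test fields, since `ν^l`
    -- takes the constant value `ν v` on them.
    have hY : ∀ i, IsSmoothField 𝓘(ℝ, E) (M := G) fun g => leftD E g (v i) := fun i =>
      isSmoothField_leftD_apply contMDiff_const
    have h1 := lieDerivative_smul_leftForm hX hφ ν (Y := fun i g => leftD E g (v i)) hY g
    rw [h _ hY g] at h1
    simp only [leftDInv_leftD] at h1
    exact (mul_eq_zero.1 h1.symm).resolve_right hv
  · intro h Y hY g
    rw [lieDerivative_smul_leftForm hX hφ ν hY g, h, zero_mul]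

theorem preserves_exp_smul_leftForm_iff {X : G → E} (hX : IsSmoothField 𝓘(ℝ, E) (M := G) X)
    {σ : G → ℝ} (hσ : IsSmoothFun 𝓘(ℝ, E) σ)
    {ν : E [⋀^Fin (Module.finrank ℝ E)]→ₗ[ℝ] ℝ} (hν : ν ≠ 0) :
    Preserves 𝓘(ℝ, E) (M := G) X (fun g => Real.exp (σ g) • leftForm 𝓘(ℝ, E) ν g) ↔
      ∀ g, derivAlong 𝓘(ℝ, E) (M := G) X σ g
        + leftDivergence (fun k => leftDInv E k (X k)) g = 0 := by
  have hexp : IsSmoothFun 𝓘(ℝ, E) fun g => Real.exp (σ g) :=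
    Real.contDiff_exp.contMDiff.comp hσ
  rw [preserves_smul_leftForm_iff hX hexp hν]
  refine forall_congr' fun g => ?_
  rw [derivAlong_comp hσ (Real.hasDerivAt_exp (σ g)), ← mul_add, mul_eq_zero,
    or_iff_right (Real.exp_ne_zero _)]

theorem exists_smooth_of_preserves {X : G → E} (hX : IsSmoothField 𝓘(ℝ, E) (M := G) X)
    {Φ : ∀ g : G, TangentSpace 𝓘(ℝ, E) g [⋀^Fin (Module.finrank ℝ E)]→ₗ[ℝ] ℝ}
    (hΦ : IsVolumeForm 𝓘(ℝ, E) Φ) (h : Preserves 𝓘(ℝ, E) (M := G) X Φ) :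
    ∃ σ : G → ℝ, IsSmoothFun 𝓘(ℝ, E) σ ∧
      ∀ g, derivAlong 𝓘(ℝ, E) (M := G) X σ g
        + leftDivergence (fun k => leftDInv E k (X k)) g = 0 := by
  let b := Module.finBasis ℝ E
  set φ : G → ℝ := fun g => Φ g fun i => leftD E g (b i) with hφ_def
  have hΦφ : Φ = fun g => φ g • leftForm 𝓘(ℝ, E) (G := G) b.det g :=
    funext fun g => eq_smul_leftForm b g (Φ g)
  have hφ : IsSmoothFun 𝓘(ℝ, E) φ :=
    hΦ.smooth (fun i g => leftD E g (b i)) fun i => isSmoothField_leftD_apply contMDiff_const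
  have hφ₀ : ∀ g, φ g ≠ 0 := fun g hg => by
    refine hΦ.ne_zero g ?_
    rw [eq_smul_leftForm b g (Φ g)]
    exact (congrArg (· • leftForm 𝓘(ℝ, E) (G := G) b.det g) hg).trans (zero_smul ℝ _)
  have hb : b.det ≠ 0 := fun hc => by
    have := b.det_self
    rw [hc] at this
    exact zero_ne_one this
  rw [hΦφ, preserves_smul_leftForm_iff hX hφ hb] at h
  -- `Real.log` is `log |·|`, smooth away from zero with derivative `1 / φ` for either sign, so `φ`
  -- need not be positive.
  refine ⟨fun g => Real.log (φ g), fun g => ?_, fun g => ?_⟩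
  · exact (Real.contDiffAt_log.2 (hφ₀ g)).contMDiffAt.comp g (hφ g)
  · rw [derivAlong_comp hφ (Real.hasDerivAt_log (hφ₀ g))]
    have h1 := h g
    have h2 := hφ₀ g
    field_simp
    rw [mul_zero]
    exact h1

theorem derivAlong_sub_log_sqrt_f₀ [ConnectedSpace G] {σ : G → ℝ} (hσ : IsSmoothFun 𝓘(ℝ, E) σ)
    (X : G → E) (g : G) :
    derivAlong 𝓘(ℝ, E) (M := G) X (fun x => σ x - Real.log (Real.sqrt (f₀ 𝓘(ℝ, E) x))) g
      = derivAlong 𝓘(ℝ, E) (M := G) X σ g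
        - 1 / 2 * LinearMap.trace ℝ E (adBracket E G (leftDInv E g (X g)) : E →ₗ[ℝ] E) := by
  obtain ⟨h1, h2⟩ := modelDeriv_log_sqrt_f₀ (E := E) g
  have h3 : modelDeriv E ℝ (fun x : G => σ x - Real.log (Real.sqrt (f₀ 𝓘(ℝ, E) x))) g
      = modelDeriv E ℝ σ g
        - modelDeriv E ℝ (fun x : G => Real.log (Real.sqrt (f₀ 𝓘(ℝ, E) x))) g :=
    mfderiv_sub ((hσ g).mdifferentiableAt (by simp)) h1
  rw [← h2]
  exact congrArg (fun L : E →L[ℝ] ℝ => L (X g)) h3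

theorem unimodularity_equation_iff [ConnectedSpace G]
    {P : ∀ g : G, Tensor2 (TangentSpace 𝓘(ℝ, E) g)} (hP : IsPoissonLie 𝓘(ℝ, E) P)
    {H : G → ℝ} (hH : IsSmoothFun 𝓘(ℝ, E) H) {σ : G → ℝ} (hσ : IsSmoothFun 𝓘(ℝ, E) σ) (g : G) :
    derivAlong 𝓘(ℝ, E) (hamiltonianField 𝓘(ℝ, E) P H)
            (fun x => σ x - Real.log (Real.sqrt (f₀ 𝓘(ℝ, E) x))) g
          + 1 / 2 *
            (derivAlong 𝓘(ℝ, E) (leftField 𝓘(ℝ, E) (dualModularCharacter 𝓘(ℝ, E) P)) H g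
            + derivAlong 𝓘(ℝ, E)
                (rightField 𝓘(ℝ, E) (dualModularCharacter 𝓘(ℝ, E) P)) H g) = 0 ↔
      derivAlong 𝓘(ℝ, E) (hamiltonianField 𝓘(ℝ, E) P H) σ g
        + leftDivergence (leftHamiltonian P H) g = 0 := by
  have e1 := derivAlong_leftField hH (dualModularCharacter 𝓘(ℝ, E) P) g
  have e2 := derivAlong_rightField hH (dualModularCharacter 𝓘(ℝ, E) P) g
  have e3 := derivAlong_sub_log_sqrt_f₀ hσ (hamiltonianField 𝓘(ℝ, E) P H) g
  have e4 := leftDivergence_leftHamiltonian hP hH g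
  refine Eq.congr ((congrArg₂ (· + ·) e3
    (congrArg (1 / 2 * ·) (congrArg₂ (· + ·) e1 e2))).trans ?_) rfl
  rw [e4, leftHamiltonian]
  ring

end VolumeForms

end PoissonLie

end

/-! ### The main theorem -/

open PoissonLie
theorem theorem3p1 {E : Type*} [NormedAddCommGroup E] [NormedSpace ℝ E] [FiniteDimensional ℝ E]
    {G : Type*} [TopologicalSpace G] [ChartedSpace E G] [Group G] [LieGroup 𝓘(ℝ, E) ∞ G]
    [ConnectedSpace G]
    (P : ∀ g : G, Tensor2 (TangentSpace 𝓘(ℝ, E) g)) (hP : IsPoissonLie 𝓘(ℝ, E) P)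
    (H : G → ℝ) (hH : IsSmoothFun 𝓘(ℝ, E) H) :
    ((∃ Φ : ∀ g : G, TangentSpace 𝓘(ℝ, E) g [⋀^Fin (Module.finrank ℝ E)]→ₗ[ℝ] ℝ,
        IsVolumeForm 𝓘(ℝ, E) Φ ∧
          Preserves 𝓘(ℝ, E) (hamiltonianField 𝓘(ℝ, E) P H) Φ) ↔
      ∃ σ : G → ℝ, IsSmoothFun 𝓘(ℝ, E) σ ∧ ∀ g : G,
        derivAlong 𝓘(ℝ, E) (hamiltonianField 𝓘(ℝ, E) P H)
            (fun x => σ x - Real.log (Real.sqrt (f₀ 𝓘(ℝ, E) x))) g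
          + 1 / 2 *
            (derivAlong 𝓘(ℝ, E) (leftField 𝓘(ℝ, E) (dualModularCharacter 𝓘(ℝ, E) P)) H g
            + derivAlong 𝓘(ℝ, E)
                (rightField 𝓘(ℝ, E) (dualModularCharacter 𝓘(ℝ, E) P)) H g) = 0) ∧
    ∀ σ : G → ℝ, IsSmoothFun 𝓘(ℝ, E) σ →
      (∀ g : G,
        derivAlong 𝓘(ℝ, E) (hamiltonianField 𝓘(ℝ, E) P H)
            (fun x => σ x - Real.log (Real.sqrt (f₀ 𝓘(ℝ, E) x))) g
          + 1 / 2 *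
            (derivAlong 𝓘(ℝ, E) (leftField 𝓘(ℝ, E) (dualModularCharacter 𝓘(ℝ, E) P)) H g
            + derivAlong 𝓘(ℝ, E)
                (rightField 𝓘(ℝ, E) (dualModularCharacter 𝓘(ℝ, E) P)) H g) = 0) →
      ∀ ν : GroupLieAlgebra 𝓘(ℝ, E) G [⋀^Fin (Module.finrank ℝ E)]→ₗ[ℝ] ℝ, ν ≠ 0 →
        IsVolumeForm 𝓘(ℝ, E) (fun g => Real.exp (σ g) • leftForm 𝓘(ℝ, E) ν g) ∧
          Preserves 𝓘(ℝ, E) (hamiltonianField 𝓘(ℝ, E) P H)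
            (fun g => Real.exp (σ g) • leftForm 𝓘(ℝ, E) ν g) := by
  have hX := isSmoothField_hamiltonianField hP.toIsPoisson hH
  have key : ∀ σ : G → ℝ, IsSmoothFun 𝓘(ℝ, E) σ →
      (∀ g : G,
        derivAlong 𝓘(ℝ, E) (hamiltonianField 𝓘(ℝ, E) P H)
            (fun x => σ x - Real.log (Real.sqrt (f₀ 𝓘(ℝ, E) x))) g
          + 1 / 2 *
            (derivAlong 𝓘(ℝ, E) (leftField 𝓘(ℝ, E) (dualModularCharacter 𝓘(ℝ, E) P)) H g
            + derivAlong 𝓘(ℝ, E)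
                (rightField 𝓘(ℝ, E) (dualModularCharacter 𝓘(ℝ, E) P)) H g) = 0) →
      ∀ ν : GroupLieAlgebra 𝓘(ℝ, E) G [⋀^Fin (Module.finrank ℝ E)]→ₗ[ℝ] ℝ, ν ≠ 0 →
        IsVolumeForm 𝓘(ℝ, E) (fun g => Real.exp (σ g) • leftForm 𝓘(ℝ, E) ν g) ∧
          Preserves 𝓘(ℝ, E) (hamiltonianField 𝓘(ℝ, E) P H)
            (fun g => Real.exp (σ g) • leftForm 𝓘(ℝ, E) ν g) := by
    intro σ hσ h ν hν
    have hexp : IsSmoothFun 𝓘(ℝ, E) fun g => Real.exp (σ g) :=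
      Real.contDiff_exp.contMDiff.comp hσ
    exact ⟨isVolumeForm_smul_leftForm hexp (fun g => Real.exp_ne_zero _) hν,
      (preserves_exp_smul_leftForm_iff hX hσ hν).2 fun g =>
        (unimodularity_equation_iff hP hH hσ g).1 (h g)⟩
  refine ⟨⟨?_, ?_⟩, key⟩
  · rintro ⟨Φ, hΦ, hpres⟩
    obtain ⟨σ, hσ, h⟩ := exists_smooth_of_preserves hX hΦ hpres
    exact ⟨σ, hσ, fun g => (unimodularity_equation_iff hP hH hσ g).2 (h g)⟩
  · rintro ⟨σ, hσ, h⟩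
    -- Any nonzero `ν` gives an invariant volume form by `key`; the determinant of a basis is one,
    -- also in dimension zero.
    have hν : (Module.finBasis ℝ E).det ≠ 0 := fun hc => by
      have h1 := (Module.finBasis ℝ E).det_self
      rw [hc] at h1
      exact zero_ne_one h1
    exact ⟨_, key σ hσ h (Module.finBasis ℝ E).det hν⟩
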